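/- For $n\in\mathbb{N}$ let $\mathbb{C}\langle n^2\rangle=\mathbb{C}\langle u_{ij}\mid 1\le i,j\le n\rangle$ be the free associative unital algebra on $n^2$ symbols, and let $I_n$ be its two-sided ideal generated by $$\sum_{\alpha=1}^n u_{i\alpha}-1,\qquad \sum_{\alpha=1}^n u_{\alpha i}-1,\qquad u_{ij}^2-u_{ij},\qquad u_{ji}u_{ki}\ (j\neq k),\qquad u_{ik}u_{ij}\ (j\neq k),$$ where $1\le i,j,k\le n$. The algebraic quantum symmetric group is the factor algebra $\mathbb{C}\langle n^2\rangle/I_n$. Polynomials are given as finite lists of terms, a term being a pair $(c,w)$ of a coefficient $c$ and a word $w$ in the symbols $u_{ij}$; such a list denotes the sum of its terms $c\,w$. Then for every $n$ the word problem in $\mathbb{C}\langle n^2\rangle/I_n$ (given two polynomials $f,g$, is $f+I_n=g+I_n$?) is decidable, and so is, equivalently, membership in $I_n$ (given a polynomial $f$, is $f\in I_n$?). Here decidability holds in both of the following senses. 1. (Turing decidability.) Let $K\subseteq\mathbb{C}$ be any computable subring, that is, a subring whose elements are encoded injectively by natural numbers such that the decoding is primitive recursive (in particular, it can be recognized which numbers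 are codes) and such that addition and multiplication are computable on codes. Then both problems, for polynomials with coefficients in $K$, are decidable by a Turing machine. 2. (Decidability in exact arithmetic, for arbitrary complex coefficients.) For each of the two problems there is a Turing computable function that maps the words occurring in the input (listed with the terms, without the coefficients) to a finite straight-line program whose instructions are: the constant $1$, addition, subtraction and multiplication of two registers, and an equality test of a register (result $1$ if it is zero, and $0$ otherwise). For all complex coefficients of the input, this program, run on the list of these coefficients, ends with the value $1$ if and only if the answer to the problem is yes. -/

import Mathlib

/-! ### The algebraic quantum symmetric group -/

namespace QSym

/-- The free associative algebra `ℂ⟨n²⟩` on the `n²` symbols `u i j`. -/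
abbrev Free (n : ℕ) : Type := FreeAlgebra ℂ (Fin n × Fin n)

/-- The symbol `u i j` as an element of `ℂ⟨n²⟩`. -/
noncomputable def u {n : ℕ} (i j : Fin n) : Free n := FreeAlgebra.ι ℂ (i, j)

/-- The row sum relation. -/
noncomputable def rs {n : ℕ} (i : Fin n) : Free n := ∑ a, u i a - 1

/-- The column sum relation. -/
noncomputable def cs {n : ℕ} (i : Fin n) : Free n := ∑ a, u a i - 1

/-- The idempotent relation. -/
noncomputable def ip {n : ℕ} (i j : Fin n) : Free n := u i j ^ 2 - u i j

/-- The orthogonal relation within a column. -/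
noncomputable def inj {n : ℕ} (j i k : Fin n) : Free n := u j i * u k i

/-- The orthogonal relation within a row. -/
noncomputable def wel {n : ℕ} (i j k : Fin n) : Free n := u i k * u i j

/-- The defining generators of the ideal of quantum symmetries. -/
def relations (n : ℕ) : Set (Free n) :=
  {f | (∃ i, f = rs i) ∨ (∃ i, f = cs i) ∨ (∃ i j, f = ip i j) ∨
    (∃ i j k, j ≠ k ∧ f = inj j i k) ∨ (∃ i j k, j ≠ k ∧ f = wel i j k)}

/-- The two-sided ideal of quantum symmetries `I_n`. -/
def idealQS (n : ℕ) : TwoSidedIdeal (Free n) := TwoSidedIdeal.span (relations n)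

/-- The algebraic quantum symmetric group, the factor algebra `ℂ⟨n²⟩ / I_n`. -/
abbrev QS (n : ℕ) : Type := (idealQS n).ringCon.Quotient

/-- The projection `ℂ⟨n²⟩ → ℂ⟨n²⟩ / I_n`. -/
noncomputable def proj (n : ℕ) : Free n →ₐ[ℂ] QS n := (idealQS n).ringCon.mkₐ ℂ

/-! ### Written polynomials, the inputs of the decision problems -/

/-- A word in the symbols `u i j`. -/
abbrev Word (n : ℕ) : Type := List (Fin n × Fin n)

/-- A noncommutative polynomial written as a finite list of terms, each of which is a coefficient
together with a word. -/
abbrev Expr (K : Type) (n : ℕ) : Type := List (K × Word n)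

/-- The monomial denoted by a word. -/
noncomputable def monomial {n : ℕ} (w : Word n) : Free n :=
  (w.map fun a => u a.1 a.2).prod

/-- The element of `ℂ⟨n²⟩` denoted by a written polynomial: the sum of its terms. -/
noncomputable def value {n : ℕ} (p : Expr ℂ n) : Free n :=
  (p.map fun t => t.1 • monomial t.2).sum

/-- A written polynomial with coefficients in a subring of `ℂ`, read over `ℂ`. -/
def toComplex {K : Subring ℂ} {n : ℕ} (p : Expr K n) : Expr ℂ n :=
  p.map fun t => ((t.1 : ℂ), t.2)

/-- The list of the words of a written polynomial (its discrete part). -/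
def words {K : Type} {n : ℕ} (p : Expr K n) : List (Word n) := p.map Prod.snd

/-- The list of the coefficients of a written polynomial (its scalar part). -/
def coeffs {K : Type} {n : ℕ} (p : Expr K n) : List K := p.map Prod.fst

/-! ### Exact arithmetic programs over `ℂ`

Arbitrary complex numbers are not finite objects. A procedure on them is a program in exact
arithmetic with equality tests, where the program is obtained from the discrete part of the input
by an ordinary (Turing computable) function. -/

/-- One instruction of an arithmetic program. Its arguments are numbers of earlier registers. -/
inductive Instr : Type
  | one
  | add (i j : ℕ)
  | sub (i j : ℕ)
  | mul (i j : ℕ)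
  | isZero (i : ℕ)

/-- The encoding of instructions by tuples of natural numbers. -/
def Instr.equiv : Instr ≃ (Unit ⊕ (ℕ × ℕ) ⊕ (ℕ × ℕ) ⊕ (ℕ × ℕ) ⊕ ℕ) where
  toFun
    | .one => .inl ()
    | .add i j => .inr (.inl (i, j))
    | .sub i j => .inr (.inr (.inl (i, j)))
    | .mul i j => .inr (.inr (.inr (.inl (i, j))))
    | .isZero i => .inr (.inr (.inr (.inr i)))
  invFun
    | .inl _ => .one
    | .inr (.inl (i, j)) => .add i j
    | .inr (.inr (.inl (i, j))) => .sub i j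
    | .inr (.inr (.inr (.inl (i, j)))) => .mul i j
    | .inr (.inr (.inr (.inr i))) => .isZero i
  left_inv x := by cases x <;> rfl
  right_inv x := by rcases x with _ | _ | _ | _ | _ <;> rfl

instance : Primcodable Instr := Primcodable.ofEquiv _ Instr.equiv

open Classical in
/-- The value computed by one instruction from the registers `r` (an absent register holds `0`).
The equality test returns `1` if the register is zero, and `0` otherwise. -/
noncomputable def Instr.exec (r : List ℂ) : Instr → ℂ
  | .one => 1
  | .add i j => r.getD i 0 + r.getD j 0
  | .sub i j => r.getD i 0 - r.getD j 0
  | .mul i j => r.getD i 0 * r.getD j 0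
  | .isZero i => if r.getD i 0 = 0 then 1 else 0

/-- Run a program: start with the scalar input `x` in the registers, and let every instruction
append one register. -/
noncomputable def run (c : List Instr) (x : List ℂ) : List ℂ :=
  c.foldl (fun r s => r ++ [s.exec r]) x

/-- A program accepts the scalar input `x` if the last register holds `1` in the end. -/
def Accepts (c : List Instr) (x : List ℂ) : Prop := (run c x).getLastD 0 = 1

/-- Decidability of a property `P` of inputs that consist of a discrete part and of a list of
complex numbers: some Turing machine turns the discrete part into a program in exact arithmetic
with equality tests (without any constants but `1`), and this program, run on the
scalar part, accepts exactly if `P` holds. -/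
def ArithDecidable {α S : Type} [Primcodable S] (discrete : α → S) (scalars : α → List ℂ)
    (P : α → Prop) : Prop :=
  ∃ c : S → List Instr, Computable c ∧ ∀ a, P a ↔ Accepts (c (discrete a)) (scalars a)

end QSym

/-!
Decidability comes from a degree bound: if a combination `x` of words of length at most `k` lies in
`I_n`, then it is a linear combination of the finitely many elements `w r w'` with `r` a defining
relation and `w`, `w'` words of length at most `k` (`mem_idealQS_iff`). Membership is then a matter
of linear algebra over `ℚ`.

The bound is proved by duality. A functional `ψ` on words that kills all `w r w'` of degree at most
`k` (`Compatible k ψ`) is to be changed on words longer than `k` so that it kills the whole ideal.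
It suffices to go from `k` to `k + 1` (`Compatible.exists_succ`). The values of `ψ` on the words of
length `k` form an operator `X` on the `k`-fold tensor power of `V = ℂⁿ`, the letter `u i j` at a
position giving the matrix indices `i`, `j` of that tensor factor. Compatibility implies that `X`
commutes with the Temperley-Lieb algebra `jones n k`, which is generated by the multiples of the
projections of a tensor factor to the vector `∑ e i`, and by the projections `diag` of two
neighbouring factors to the span of the `e i ⊗ e i`. With `cap v = (∑ e i) ⊗ v` and its adjoint
`cup`, one needs an operator `Y` in the commutant of `jones n (k + 1)` with `Y cap = cap X` and
`cup Y = X cup`. The formula `Y (a (cap v)) = a (cap (X v))`, for `a` in `jones n (k + 1)`, and `0`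
on the orthogonal complement, works as soon as `cup a cap` commutes with `X`
(`exists_commuting_extension`). This holds because of Jones' observation that every element of a
Temperley-Lieb algebra is a sum of products in which the last generator occurs at most once
(`sup_adjoin_induction`); hence `cup a cap ∈ jones n k` (`compression_jones_mem`). Finally,
neighbouring generators of the algebra exchange the relations at neighbouring positions of a word,
so that commutation and the row and column sum relations at the front of the word give all relations
(`Invariant.sums`).

The algorithm starts with the coordinate functionals of all the words that occur and eliminates the
elements `w r w'` one after the other without fractions (`mem_commonKer_foldl`). The resulting
integral functionals have, among the combinations of these words, the span of the `w r w'` as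
common kernel, and an arithmetic program
evaluates them on the coefficients of the input (`accepts_membershipProgram_iff`). Integers are
written in unary as lists of signs, so that all steps are list operations, which are primitive
recursive (`primrec_membershipProgram`). Turing decidability over a computable subring `K` follows
by running the program with registers in `K` (`computablePred_accepts`).
-/

namespace QSym

/-! ### Extension of operators in a commutant -/

section Extension

variable {V W 𝒜 : Type*} [NormedAddCommGroup V] [InnerProductSpace ℂ V] [FiniteDimensional ℂ V]
  [NormedAddCommGroup W] [InnerProductSpace ℂ W] [FiniteDimensional ℂ W]

open LinearMap in
/-- Extension of an operator along `ι : V → W` to an operator commuting with a self-adjoint family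
`a` of operators closed under products. If `X` commutes with all compressions `ι† (a i) ι`, then
`a i ι v ↦ a i ι (X v)` is well defined on the span of the vectors `a i ι v`, and it is extended by
zero on the orthogonal complement. -/
theorem exists_commuting_extension (a : 𝒜 → W →ₗ[ℂ] W) (h_one : ∃ i, a i = LinearMap.id)
    (h_mul : ∀ i j, ∃ k, a k = a i ∘ₗ a j) (h_star : ∀ i, ∃ j, a j = adjoint (a i))
    (ι : V →ₗ[ℂ] W) (X : V →ₗ[ℂ] V)
    (hX : ∀ i, X ∘ₗ (adjoint ι ∘ₗ a i ∘ₗ ι) = (adjoint ι ∘ₗ a i ∘ₗ ι) ∘ₗ X) :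
    ∃ Y : W →ₗ[ℂ] W, (∀ i, Y ∘ₗ a i = a i ∘ₗ Y) ∧ Y ∘ₗ ι = ι ∘ₗ X ∧
      adjoint ι ∘ₗ Y = X ∘ₗ adjoint ι := by
  classical
  let Φ : (𝒜 →₀ V) →ₗ[ℂ] W := Finsupp.lsum ℂ fun i => a i ∘ₗ ι
  let m (Z : V →ₗ[ℂ] V) : (𝒜 →₀ V) →ₗ[ℂ] (𝒜 →₀ V) := Finsupp.mapRange.linearMap Z
  have hΦ (i : 𝒜) (v : V) : Φ (Finsupp.single i v) = a i (ι v) := by simp [Φ]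
  have hm (Z : V →ₗ[ℂ] V) (i : 𝒜) (v : V) :
      m Z (Finsupp.single i v) = Finsupp.single i (Z v) := by simp [m]
  -- Moving `X` across the inner product shows that `Φ p = 0` implies `Φ (m X p) = 0`.
  have inner_move (p q : 𝒜 →₀ V) :
      inner ℂ (Φ q) (Φ (m X p)) = inner ℂ (Φ (m (adjoint X) q)) (Φ p) := by
    induction p using Finsupp.induction_linear with
    | zero => simp
    | add p p' hp hp' => simp [hp, hp']
    | single i v =>
      induction q using Finsupp.induction_linear with
      | zero => simp
      | add q q' hq hq' => simp [hq, hq']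
      | single j w =>
        rw [hm, hm, hΦ, hΦ, hΦ, hΦ]
        obtain ⟨j', hj'⟩ := h_star j
        obtain ⟨l, hl⟩ := h_mul j' i
        have key : adjoint ι (a j' (a i (ι (X v)))) = X (adjoint ι (a j' (a i (ι v)))) := by
          have := congrArg (fun f => f v) (hX l)
          simp only [hl, LinearMap.comp_apply] at this
          exact this.symm
        rw [← adjoint_inner_right, ← hj', ← adjoint_inner_right, key, ← adjoint_inner_left,
          adjoint_inner_right, hj', adjoint_inner_right]
  have hker (p : 𝒜 →₀ V) (hp : Φ p = 0) : Φ (m X p) = 0 := by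
    rw [← inner_self_eq_zero (𝕜 := ℂ), inner_move, hp, inner_zero_right]
  set K := range Φ with hK
  obtain ⟨s, hs⟩ := Φ.rangeRestrict.exists_rightInverse_of_surjective Φ.range_rangeRestrict
  -- `s` chooses preimages under `Φ`; the choice does not matter because of `hker`.
  let Y : W →ₗ[ℂ] W := Φ ∘ₗ m X ∘ₗ s ∘ₗ K.orthogonalProjectionOnto.toLinearMap
  have hYΦ (p : 𝒜 →₀ V) : Y (Φ p) = Φ (m X p) := by
    have hmem : Φ p ∈ K := mem_range_self Φ p
    have h1 : Y (Φ p) = Φ (m X (s ⟨Φ p, hmem⟩)) := by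
      have h2 : K.orthogonalProjectionOnto (Φ p) = ⟨Φ p, hmem⟩ :=
        Submodule.orthogonalProjectionOnto_mem_subspace_eq_self (K := K) ⟨Φ p, hmem⟩
      simp only [Y, LinearMap.comp_apply, ContinuousLinearMap.coe_coe, h2]
    have h3 : Φ (s ⟨Φ p, hmem⟩) = Φ p :=
      congrArg Subtype.val (LinearMap.congr_fun hs ⟨Φ p, hmem⟩)
    rw [h1, ← sub_eq_zero, ← map_sub, ← map_sub]
    exact hker _ (by rw [map_sub, h3, sub_self])
  have hY0 (w : W) (hw : w ∈ Kᗮ) : Y w = 0 := by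
    have h2 : K.orthogonalProjectionOnto w = 0 :=
      Submodule.orthogonalProjectionOnto_apply_of_mem_orthogonal hw
    simp only [Y, LinearMap.comp_apply, ContinuousLinearMap.coe_coe, h2, map_zero]
  have haΦ (i : 𝒜) (p : 𝒜 →₀ V) : ∃ q, Φ q = a i (Φ p) ∧ Φ (m X q) = a i (Φ (m X p)) := by
    induction p using Finsupp.induction_linear with
    | zero => exact ⟨0, by simp⟩
    | add p p' hp hp' =>
      obtain ⟨q, h1, h2⟩ := hp
      obtain ⟨q', h3, h4⟩ := hp'
      exact ⟨q + q', by simp [h1, h3], by simp [h2, h4]⟩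
    | single j v =>
      obtain ⟨l, hl⟩ := h_mul i j
      exact ⟨Finsupp.single l v, by rw [hΦ, hΦ, hl]; rfl, by rw [hm, hm, hΦ, hΦ, hl]; rfl⟩
  have ha0 (i : 𝒜) (w : W) (hw : w ∈ Kᗮ) : a i w ∈ Kᗮ := by
    rw [Submodule.mem_orthogonal] at hw ⊢
    rintro _ ⟨p, rfl⟩
    obtain ⟨j, hj⟩ := h_star i
    obtain ⟨q, hq, -⟩ := haΦ j p
    rw [← adjoint_inner_left, ← hj, ← hq]
    exact hw _ (mem_range_self Φ q)
  obtain ⟨i₀, hi₀⟩ := h_one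
  have hι (v : V) : ι v = Φ (Finsupp.single i₀ v) := by rw [hΦ, hi₀]; rfl
  have hι0 (w : W) (hw : w ∈ Kᗮ) : adjoint ι w = 0 := by
    rw [← inner_self_eq_zero (𝕜 := ℂ), adjoint_inner_right, hι]
    exact (Submodule.mem_orthogonal _ _).1 hw _ (mem_range_self Φ _)
  refine ⟨Y, fun i => ?_, ?_, ?_⟩
  · ext w
    obtain ⟨y, ⟨p, rfl⟩, z, hz, rfl⟩ := Submodule.exists_add_mem_mem_orthogonal (K := K) w
    obtain ⟨q, h1, h2⟩ := haΦ i p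
    simp only [LinearMap.comp_apply, map_add, hY0 z hz, hY0 _ (ha0 i z hz), map_zero, add_zero,
      hYΦ, ← h1, h2]
  · ext v
    simp only [LinearMap.comp_apply, hι, hYΦ, hm]
  · ext w
    obtain ⟨y, ⟨p, rfl⟩, z, hz, rfl⟩ := Submodule.exists_add_mem_mem_orthogonal (K := K) w
    simp only [LinearMap.comp_apply, map_add, hY0 z hz, hι0 z hz, map_zero, add_zero, hYΦ]
    induction p using Finsupp.induction_linear with
    | zero => simp
    | add p p' hp hp' => simp only [map_add, hp, hp']
    | single j v =>
      rw [hm, hΦ, hΦ]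
      exact (LinearMap.congr_fun (hX j) v).symm

end Extension

/-- The matrix form of `exists_commuting_extension`. -/
theorem exists_matrix_extension {S T : Type*} [Fintype S] [DecidableEq S] [Fintype T]
    [DecidableEq T] (A : Subalgebra ℂ (Matrix T T ℂ)) (hA : ∀ a ∈ A, a.conjTranspose ∈ A)
    (ι : Matrix T S ℂ) (X : Matrix S S ℂ)
    (hX : ∀ a ∈ A, X * (ι.conjTranspose * a * ι) = (ι.conjTranspose * a * ι) * X) :
    ∃ Y : Matrix T T ℂ, (∀ a ∈ A, Y * a = a * Y) ∧ Y * ι = ι * X ∧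
      ι.conjTranspose * Y = X * ι.conjTranspose := by
  obtain ⟨Y, h1, h2, h3⟩ := exists_commuting_extension
    (fun a : A => Matrix.toEuclideanLin (a : Matrix T T ℂ)) ⟨1, by simp⟩
    (fun a b => ⟨a * b, by simp [← Matrix.toLpLin_mul_same]⟩)
    (fun a => ⟨⟨_, hA a a.2⟩, Matrix.toEuclideanLin_conjTranspose_eq_adjoint _⟩)
    (Matrix.toEuclideanLin ι) (Matrix.toEuclideanLin X) (by
      intro a
      rw [← Matrix.toEuclideanLin_conjTranspose_eq_adjoint]
      simp only [← Matrix.toLpLin_mul_same]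
      rw [← Matrix.mul_assoc ι.conjTranspose, hX a a.2])
  obtain ⟨Y, rfl⟩ := (Matrix.toEuclideanLin (𝕜 := ℂ) (m := T) (n := T)).surjective Y
  rw [← Matrix.toEuclideanLin_conjTranspose_eq_adjoint] at h3
  simp only [← Matrix.toLpLin_mul_same, EmbeddingLike.apply_eq_iff_eq] at h1 h2 h3
  exact ⟨Y, fun a ha => h1 ⟨a, ha⟩, h2, h3⟩

/-! ### Jones' basic construction and the Temperley-Lieb algebras -/

section Jones

variable {R : Type*} [Ring R] [Algebra ℂ R]

/-- If `e x e ∈ S e` for all `x` in the subalgebra `S`, then the algebra generated by `S` and `e`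
is spanned by `S` and `S e S`: one occurrence of `e` is enough. -/
theorem sup_adjoin_induction {S : Subalgebra ℂ R} {e : R}
    (he : ∀ x ∈ S, ∃ y ∈ S, e * x * e = y * e) {p : R → Prop} (mem : ∀ x ∈ S, p x)
    (sandwich : ∀ x ∈ S, ∀ y ∈ S, p (x * e * y)) (add : ∀ x y, p x → p y → p (x + y)) :
    ∀ z ∈ S ⊔ Algebra.adjoin ℂ {e}, p z := by
  let M : Submodule ℂ R := Subalgebra.toSubmodule S ⊔
    Submodule.span ℂ {z | ∃ x ∈ S, ∃ y ∈ S, x * e * y = z}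
  have hS {x : R} (hx : x ∈ S) : x ∈ M := Submodule.mem_sup_left hx
  have hE {x y : R} (hx : x ∈ S) (hy : y ∈ S) : x * e * y ∈ M :=
    Submodule.mem_sup_right (Submodule.subset_span ⟨x, hx, y, hy, rfl⟩)
  have hind {q : R → Prop} (h1 : ∀ x ∈ S, q x) (h2 : ∀ x ∈ S, ∀ y ∈ S, q (x * e * y))
      (h3 : ∀ x y, q x → q y → q (x + y)) : ∀ z ∈ M, q z := by
    intro z hz
    obtain ⟨x, hx, y, hy, rfl⟩ := Submodule.mem_sup.1 hz
    refine h3 _ _ (h1 x hx) ?_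
    clear hz
    suffices h : ∀ c : ℂ, q (c • y) by simpa using h 1
    induction hy using Submodule.span_induction with
    | mem y hy =>
      obtain ⟨a, ha, b, hb, rfl⟩ := hy
      intro c
      rw [← smul_mul_assoc, ← smul_mul_assoc]
      exact h2 _ (S.smul_mem ha c) b hb
    | zero => intro c; rw [smul_zero]; exact h1 0 S.zero_mem
    | add y y' _ _ hy hy' => intro c; rw [smul_add]; exact h3 _ _ (hy c) (hy' c)
    | smul d y _ hy => intro c; rw [smul_smul]; exact hy (c * d)
  -- `M` is stable under left multiplication by `S` and, because of `he`, by `e`.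
  have hmul : ∀ z ∈ S ⊔ Algebra.adjoin ℂ {e}, ∀ m ∈ M, z * m ∈ M := by
    intro z hz
    rw [← Algebra.adjoin_eq S, ← Algebra.adjoin_union] at hz
    induction hz using Algebra.adjoin_induction with
    | mem z hz =>
      rcases hz with hz | rfl
      · exact hind (fun x hx => hS (S.mul_mem hz hx))
          (fun x hx y hy => by
            rw [← mul_assoc, ← mul_assoc]; exact hE (S.mul_mem hz hx) hy)
          (fun x y hx hy => by rw [mul_add]; exact M.add_mem hx hy)
      · refine hind (fun x hx => ?_) (fun x hx y hy => ?_)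
          (fun x y hx hy => by rw [mul_add]; exact M.add_mem hx hy)
        · simpa using hE S.one_mem hx
        · obtain ⟨x', hx', h⟩ := he x hx
          rw [← mul_assoc, ← mul_assoc, h]
          exact hE hx' hy
    | algebraMap c => intro m hm; rw [← Algebra.smul_def]; exact M.smul_mem c hm
    | add x y _ _ hx hy => intro m hm; rw [add_mul]; exact M.add_mem (hx m hm) (hy m hm)
    | mul x y _ _ hx hy => intro m hm; rw [mul_assoc]; exact hx _ (hy m hm)
  intro z hz
  refine hind mem sandwich add z ?_
  simpa using hmul z hz 1 (hS S.one_mem)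

end Jones

open Matrix

section Operators

variable {n : ℕ} {T : Type} [DecidableEq T]

/-- The insertion `v ↦ (∑ i, e i) ⊗ v`. -/
def cap (n : ℕ) (T : Type) [DecidableEq T] : Matrix (Fin n × T) T ℂ :=
  .of fun x t => if x.2 = t then 1 else 0

/-- The projection onto the span of the vectors `e i ⊗ e i ⊗ v`. -/
def diag (n : ℕ) (T : Type) [DecidableEq T] : Matrix (Fin n × Fin n × T) (Fin n × Fin n × T) ℂ :=
  Matrix.diagonal fun x => if x.1 = x.2.1 then 1 else 0

/-- The adjoint of `cap`. -/
def cup (n : ℕ) (T : Type) [DecidableEq T] : Matrix T (Fin n × T) ℂ :=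
  .of fun t x => if x.2 = t then 1 else 0

theorem conjTranspose_cap : conjTranspose (cap n T) = cup n T := by
  ext t x
  by_cases h : x.2 = t <;> simp [cap, cup, h]

theorem conjTranspose_cup : conjTranspose (cup n T) = cap n T := by
  rw [← conjTranspose_cap, conjTranspose_conjTranspose]

theorem cup_apply (t : T) (x : Fin n × T) : cup n T t x = if x.2 = t then 1 else 0 := rfl

theorem cap_apply (x : Fin n × T) (t : T) : cap n T x t = if x.2 = t then 1 else 0 := rfl

theorem conjTranspose_diag : conjTranspose (diag n T) = diag n T := by
  rw [diag, Matrix.diagonal_conjTranspose]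
  congr 1
  ext x
  by_cases h : x.1 = x.2.1 <;> simp [h]

variable [Fintype T]

/-- The operator `1 ⊗ a`. -/
def amplify (n : ℕ) : Matrix T T ℂ →ₐ[ℂ] Matrix (Fin n × T) (Fin n × T) ℂ where
  toFun a := .of fun x y => if x.1 = y.1 then a x.2 y.2 else 0
  map_one' := by
    ext ⟨i, s⟩ ⟨j, t⟩
    by_cases h : i = j <;> by_cases h' : s = t <;> simp [Matrix.one_apply, h, h']
  map_mul' a b := by
    ext ⟨i, s⟩ ⟨j, t⟩
    by_cases h : i = j <;> simp [Matrix.mul_apply, Fintype.sum_prod_type, h]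
  map_zero' := by ext; simp
  map_add' a b := by ext x y; by_cases h : x.1 = y.1 <;> simp [h]
  commutes' c := by
    ext ⟨i, s⟩ ⟨j, t⟩
    by_cases h : i = j <;> by_cases h' : s = t <;>
      simp [Matrix.algebraMap_matrix_apply, h, h']

theorem amplify_apply (a : Matrix T T ℂ) (x y : Fin n × T) :
    amplify n a x y = if x.1 = y.1 then a x.2 y.2 else 0 := rfl

theorem amplify_mul_cap (a : Matrix T T ℂ) : amplify n a * cap n T = cap n T * a := by
  ext ⟨i, s⟩ t
  simp [Matrix.mul_apply, Fintype.sum_prod_type, amplify_apply, cap_apply]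

theorem conjTranspose_amplify (a : Matrix T T ℂ) :
    conjTranspose (amplify n a) = amplify n (conjTranspose a) := by
  ext ⟨i, s⟩ ⟨j, t⟩
  by_cases h : i = j <;> simp [amplify_apply, h, eq_comm]

theorem cup_mul_amplify (a : Matrix T T ℂ) : cup n T * amplify n a = a * cup n T := by
  rw [← conjTranspose_inj, conjTranspose_mul, conjTranspose_mul, conjTranspose_amplify,
    conjTranspose_cup, amplify_mul_cap]

theorem cup_mul_cap : cup n T * cap n T = algebraMap ℂ _ (n : ℂ) := by
  ext s t
  by_cases h : s = t <;> simp [Matrix.mul_apply, Fintype.sum_prod_type, cap_apply,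
    cup_apply, Matrix.algebraMap_matrix_apply, h, eq_comm]

theorem diag_mul_diag : diag n T * diag n T = diag n T := by
  simp [diag, Matrix.diagonal_mul_diagonal]

theorem diag_mul_amplify_amplify (a : Matrix T T ℂ) :
    diag n T * amplify n (amplify n a) = amplify n (amplify n a) * diag n T := by
  ext ⟨i, j, s⟩ ⟨i', j', t⟩
  by_cases h : i = i' <;> by_cases h' : j = j' <;>
    simp [diag, amplify_apply, h, h']

theorem diag_mul_amplify_diag : diag n (Fin n × T) * amplify n (diag n T) =
    amplify n (diag n T) * diag n (Fin n × T) := by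
  ext ⟨i, j, s⟩ ⟨i', j', t⟩
  rw [diag, diag, Matrix.diagonal_mul, Matrix.mul_diagonal, mul_comm]
  simp only [amplify_apply, Matrix.diagonal_apply]
  by_cases h : i = i' <;> by_cases h' : (j, s) = (j', t) <;> simp [h, h']
  simp_all

theorem diag_mul_amplify_cap_mul_diag :
    diag n T * amplify n (cap n T * cup n T) * diag n T = diag n T := by
  ext ⟨i, j, s⟩ ⟨i', j', t⟩
  rw [diag, Matrix.mul_diagonal, Matrix.diagonal_mul]
  simp only [amplify_apply, Matrix.mul_apply, cap_apply, cup_apply, Matrix.diagonal_apply]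
  by_cases h : i = j <;> by_cases h' : i' = j' <;> by_cases h'' : i = i' <;> by_cases h3 : s = t <;>
    simp_all [eq_comm]

theorem cup_mul_diag_mul_cap : cup n (Fin n × T) * diag n T * cap n (Fin n × T) = 1 := by
  ext ⟨i, s⟩ ⟨j, t⟩
  rw [Matrix.mul_assoc, diag, Matrix.mul_apply]
  rw [Fintype.sum_prod_type]
  simp [Matrix.diagonal_mul, cap_apply, cup_apply, Matrix.one_apply]
  exact if_congr (by simp [eq_comm]) rfl rfl

/-- The algebra generated by `1 ⊗ A` and the projection `diag`. -/
def joinDiag (A : Subalgebra ℂ (Matrix (Fin n × T) (Fin n × T) ℂ)) :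
    Subalgebra ℂ (Matrix (Fin n × Fin n × T) (Fin n × Fin n × T) ℂ) :=
  A.map (amplify n) ⊔ Algebra.adjoin ℂ {diag n T}

/-- The algebra generated by `B` and the multiple `cap * cup` of a rank one projection on the
first tensor factor. -/
def joinCap (B : Subalgebra ℂ (Matrix (Fin n × T) (Fin n × T) ℂ)) :
    Subalgebra ℂ (Matrix (Fin n × T) (Fin n × T) ℂ) :=
  B ⊔ Algebra.adjoin ℂ {cap n T * cup n T}

/-- The hypothesis of `sup_adjoin_induction` for `cap * cup`. -/
theorem cap_sandwich {A : Subalgebra ℂ (Matrix T T ℂ)}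
    {B : Subalgebra ℂ (Matrix (Fin n × T) (Fin n × T) ℂ)} (hAB : A.map (amplify n) ≤ B)
    (hB : ∀ x ∈ B, cup n T * x * cap n T ∈ A) :
    ∀ x ∈ B, ∃ y ∈ B, cap n T * cup n T * x * (cap n T * cup n T) = y * (cap n T * cup n T) := by
  intro x hx
  refine ⟨amplify n (cup n T * x * cap n T), hAB ⟨_, hB x hx, rfl⟩, ?_⟩
  rw [← Matrix.mul_assoc (amplify n _), amplify_mul_cap]
  simp only [Matrix.mul_assoc]

theorem compression_joinCap_mem {A : Subalgebra ℂ (Matrix T T ℂ)}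
    {B : Subalgebra ℂ (Matrix (Fin n × T) (Fin n × T) ℂ)} (hAB : A.map (amplify n) ≤ B)
    (hB : ∀ x ∈ B, cup n T * x * cap n T ∈ A) : ∀ x ∈ joinCap B, cup n T * x * cap n T ∈ A := by
  refine sup_adjoin_induction (cap_sandwich hAB hB) hB (fun x hx y hy => ?_) (fun x y hx hy => ?_)
  · have : cup n T * (x * (cap n T * cup n T) * y) * cap n T =
        (cup n T * x * cap n T) * (cup n T * y * cap n T) := by
      simp only [Matrix.mul_assoc]
    rw [this]
    exact A.mul_mem (hB x hx) (hB y hy)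
  · rw [Matrix.mul_add, Matrix.add_mul]
    exact A.add_mem hx hy

/-- The hypothesis of `sup_adjoin_induction` for `diag`. -/
theorem diag_sandwich {A : Subalgebra ℂ (Matrix T T ℂ)}
    {B : Subalgebra ℂ (Matrix (Fin n × T) (Fin n × T) ℂ)} (hAB : A.map (amplify n) ≤ B)
    (hB : ∀ x ∈ B, cup n T * x * cap n T ∈ A)
    (hcomm : ∀ x ∈ B, diag n T * amplify n x = amplify n x * diag n T) :
    ∀ x ∈ (joinCap B).map (amplify n), ∃ y ∈ (joinCap B).map (amplify n),
      diag n T * x * diag n T = y * diag n T := by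
  rintro _ ⟨x, hx, rfl⟩
  have hle : B ≤ joinCap B := le_sup_left
  suffices h : ∃ y ∈ joinCap B, diag n T * amplify n x * diag n T = amplify n y * diag n T by
    obtain ⟨y, hy, h⟩ := h
    exact ⟨_, ⟨y, hy, rfl⟩, h⟩
  revert x
  refine sup_adjoin_induction (cap_sandwich hAB hB) (fun x hx => ?_) (fun x hx y hy => ?_)
    (fun x y hx hy => ?_)
  · exact ⟨x, hle hx, by rw [hcomm x hx, Matrix.mul_assoc, diag_mul_diag]⟩
  · refine ⟨x * y, hle (B.mul_mem hx hy), ?_⟩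
    calc diag n T * amplify n (x * (cap n T * cup n T) * y) * diag n T
        = (diag n T * amplify n x) * amplify n (cap n T * cup n T) * (amplify n y * diag n T) := by
          rw [map_mul, map_mul]; simp only [Matrix.mul_assoc]
      _ = amplify n x * (diag n T * amplify n (cap n T * cup n T) * diag n T) * amplify n y := by
          rw [hcomm x hx, ← hcomm y hy]; simp only [Matrix.mul_assoc]
      _ = amplify n (x * y) * diag n T := by
          rw [diag_mul_amplify_cap_mul_diag, Matrix.mul_assoc, hcomm y hy, map_mul,
            Matrix.mul_assoc]
  · obtain ⟨a, ha, ha'⟩ := hx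
    obtain ⟨b, hb, hb'⟩ := hy
    exact ⟨a + b, add_mem ha hb, by
      rw [map_add, map_add, Matrix.mul_add, Matrix.add_mul, Matrix.add_mul, ha', hb']⟩

theorem compression_joinDiag_mem {A : Subalgebra ℂ (Matrix (Fin n × T) (Fin n × T) ℂ)}
    (hA : ∀ x ∈ A.map (amplify n), ∃ y ∈ A.map (amplify n),
      diag n T * x * diag n T = y * diag n T) :
    ∀ x ∈ joinDiag A, cup n (Fin n × T) * x * cap n (Fin n × T) ∈ A := by
  refine sup_adjoin_induction hA ?_ ?_ (fun x y hx hy => ?_)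
  · rintro _ ⟨x, hx, rfl⟩
    change cup n (Fin n × T) * amplify n x * cap n (Fin n × T) ∈ A
    rw [cup_mul_amplify, Matrix.mul_assoc, cup_mul_cap]
    exact A.mul_mem hx (A.algebraMap_mem _)
  · rintro _ ⟨x, hx, rfl⟩ _ ⟨y, hy, rfl⟩
    change cup n (Fin n × T) * (amplify n x * diag n T * amplify n y) * cap n (Fin n × T) ∈ A
    have : cup n (Fin n × T) * (amplify n x * diag n T * amplify n y) * cap n (Fin n × T) =
        (cup n (Fin n × T) * amplify n x) * diag n T * (amplify n y * cap n (Fin n × T)) := by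
      simp only [Matrix.mul_assoc]
    rw [this, cup_mul_amplify, amplify_mul_cap]
    have : x * cup n (Fin n × T) * diag n T * (cap n (Fin n × T) * y) =
        x * (cup n (Fin n × T) * diag n T * cap n (Fin n × T)) * y := by
      simp only [Matrix.mul_assoc]
    rw [this, cup_mul_diag_mul_cap, Matrix.mul_one]
    exact A.mul_mem hx hy
  · rw [Matrix.mul_add, Matrix.add_mul]
    exact A.add_mem hx hy

/-- Both `1 ⊗ 1 ⊗ a` and `1 ⊗ diag` commute with `diag` on the first two tensor factors. -/
theorem diag_comm_joinDiag (A : Subalgebra ℂ (Matrix (Fin n × T) (Fin n × T) ℂ)) :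
    ∀ x ∈ joinDiag A, diag n (Fin n × T) * amplify n x = amplify n x * diag n (Fin n × T) := by
  intro x hx
  rw [joinDiag, ← Algebra.adjoin_eq (A.map (amplify n)), ← Algebra.adjoin_union] at hx
  induction hx using Algebra.adjoin_induction with
  | mem x hx =>
    rcases hx with ⟨a, _, rfl⟩ | rfl
    · exact diag_mul_amplify_amplify a
    · exact diag_mul_amplify_diag
  | algebraMap c => rw [AlgHom.commutes]; exact (Algebra.commutes c _).symm
  | add x y _ _ hx hy => rw [map_add, mul_add, add_mul, hx, hy]
  | mul x y _ _ hx hy => rw [map_mul, ← mul_assoc, hx, mul_assoc, hy, mul_assoc]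

theorem conjTranspose_mem_sup_adjoin {S : Subalgebra ℂ (Matrix T T ℂ)} {e : Matrix T T ℂ}
    (hS : ∀ x ∈ S, conjTranspose x ∈ S) (he : conjTranspose e = e) :
    ∀ x ∈ S ⊔ Algebra.adjoin ℂ {e}, conjTranspose x ∈ S ⊔ Algebra.adjoin ℂ {e} := by
  intro x hx
  rw [← Algebra.adjoin_eq S, ← Algebra.adjoin_union] at hx ⊢
  induction hx using Algebra.adjoin_induction with
  | mem x hx =>
    rcases hx with hx | rfl
    · exact Algebra.subset_adjoin (Or.inl (hS x hx))
    · exact Algebra.subset_adjoin (Or.inr he)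
  | algebraMap c =>
    rw [← Matrix.star_eq_conjTranspose, ← algebraMap_star_comm]
    exact Subalgebra.algebraMap_mem _ _
  | add x y _ _ hx hy => rw [conjTranspose_add]; exact add_mem hx hy
  | mul x y _ _ hx hy => rw [conjTranspose_mul]; exact mul_mem hy hx

end Operators

/-- The indices of the standard basis of the `k`-fold tensor power of `ℂⁿ`. -/
def Idx (n : ℕ) : ℕ → Type
  | 0 => Unit
  | k + 1 => Fin n × Idx n k

instance Idx.fintype (n : ℕ) : ∀ k, Fintype (Idx n k)
  | 0 => inferInstanceAs (Fintype Unit)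
  | k + 1 => haveI := Idx.fintype n k; inferInstanceAs (Fintype (Fin n × Idx n k))

instance Idx.decidableEq (n : ℕ) : ∀ k, DecidableEq (Idx n k)
  | 0 => inferInstanceAs (DecidableEq Unit)
  | k + 1 => haveI := Idx.decidableEq n k; inferInstanceAs (DecidableEq (Fin n × Idx n k))

/-- One step of the tower `jones`: the algebra generated by `1 ⊗ A` and by `diag` on the first two
tensor factors (if there are two). -/
def jonesLower (n : ℕ) : (k : ℕ) → Subalgebra ℂ (Matrix (Idx n k) (Idx n k) ℂ) →
    Subalgebra ℂ (Matrix (Fin n × Idx n k) (Fin n × Idx n k) ℂ)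
  | 0, _ => ⊥
  | _ + 1, A => joinDiag A

/-- The Temperley-Lieb algebra with `2 k - 1` Jones generators, acting on the `k`-fold tensor power
of `ℂⁿ`. -/
def jones (n : ℕ) : (k : ℕ) → Subalgebra ℂ (Matrix (Idx n k) (Idx n k) ℂ)
  | 0 => ⊥
  | k + 1 => joinCap (jonesLower n k (jones n k))

theorem map_amplify_le_jonesLower (n : ℕ) :
    ∀ k, (jones n k).map (amplify n) ≤ jonesLower n k (jones n k)
  | 0 => by rw [jones, jonesLower, Algebra.map_bot]
  | _ + 1 => le_sup_left (a := Subalgebra.map (amplify n) (jones n _))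

theorem compression_jonesLower_mem (n : ℕ) :
    ∀ k, ∀ x ∈ jonesLower n k (jones n k), cup n (Idx n k) * x * cap n (Idx n k) ∈ jones n k
  | 0 => by
    intro x hx
    obtain ⟨c, rfl⟩ := Algebra.mem_bot.1 hx
    rw [Algebra.algebraMap_eq_smul_one, Matrix.mul_smul, Matrix.mul_one, Matrix.smul_mul,
      cup_mul_cap]
    exact Subalgebra.smul_mem _ (Subalgebra.algebraMap_mem _ _) c
  | k + 1 => by
    refine compression_joinDiag_mem (T := Idx n k)
      (diag_sandwich (map_amplify_le_jonesLower n k) (compression_jonesLower_mem n k) ?_)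
    match k with
    | 0 =>
      intro x hx
      obtain ⟨c, rfl⟩ := Algebra.mem_bot.1 hx
      rw [AlgHom.commutes]; exact (Algebra.commutes c _).symm
    | k + 1 => exact diag_comm_joinDiag (T := Idx n k) _

theorem compression_jones_mem (n k : ℕ) :
    ∀ x ∈ jones n (k + 1), cup n (Idx n k) *
      (show Matrix (Fin n × Idx n k) (Fin n × Idx n k) ℂ from x) * cap n (Idx n k) ∈
      jones n k :=
  compression_joinCap_mem (map_amplify_le_jonesLower n k) (compression_jonesLower_mem n k)

theorem conjTranspose_mem_jones (n : ℕ) : ∀ k, ∀ x ∈ jones n k, conjTranspose x ∈ jones n k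
  | 0 => by
    intro x hx
    obtain ⟨c, rfl⟩ := Algebra.mem_bot.1 hx
    rw [← Matrix.star_eq_conjTranspose, ← algebraMap_star_comm]
    exact Subalgebra.algebraMap_mem _ _
  | k + 1 => by
    have hmap : ∀ x ∈ (jones n k).map (amplify n),
        conjTranspose x ∈ (jones n k).map (amplify n) := by
      rintro _ ⟨a, ha, rfl⟩
      exact ⟨conjTranspose a, conjTranspose_mem_jones n k a ha, (conjTranspose_amplify a).symm⟩
    refine conjTranspose_mem_sup_adjoin (T := Fin n × Idx n k) ?_
      (by rw [conjTranspose_mul, conjTranspose_cup, conjTranspose_cap])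
    match k, hmap with
    | 0, _ =>
      intro x hx
      obtain ⟨c, rfl⟩ := Algebra.mem_bot.1 hx
      rw [← Matrix.star_eq_conjTranspose, ← algebraMap_star_comm]
      exact Subalgebra.algebraMap_mem _ _
    | k + 1, hmap => exact conjTranspose_mem_sup_adjoin hmap (conjTranspose_diag (T := Idx n k))

variable {n : ℕ}

/-! ### Functionals compatible with the relations -/

section Blocks

/-- The word with the given row and column indices. -/
def wordOf : (k : ℕ) → Idx n k → Idx n k → Word n
  | 0, _, _ => []
  | k + 1, x, y => (x.1, y.1) :: wordOf k x.2 y.2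

theorem exists_wordOf : ∀ w : Word n, ∃ x y, wordOf w.length x y = w
  | [] => ⟨(), (), rfl⟩
  | a :: w => by
    obtain ⟨x, y, h⟩ := exists_wordOf w
    exact ⟨(a.1, x), (a.2, y), by
      change (a.1, a.2) :: wordOf w.length x y = a :: w
      rw [h]⟩

/-- The values of `ψ` on the words of length `k`, as an operator on the `k`-fold tensor power. -/
def block (k : ℕ) (ψ : Word n → ℂ) : Matrix (Idx n k) (Idx n k) ℂ :=
  .of fun x y => ψ (wordOf k x y)

theorem length_wordOf : ∀ (k : ℕ) (x y : Idx n k), (wordOf k x y).length = k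
  | 0, _, _ => rfl
  | k + 1, x, y => congrArg (· + 1) (length_wordOf k x.2 y.2)

/-- `block (k + 1) ψ`, with the first tensor factor split off. -/
def blockSucc (k : ℕ) (ψ : Word n → ℂ) : Matrix (Fin n × Idx n k) (Fin n × Idx n k) ℂ :=
  .of fun x y => ψ ((x.1, y.1) :: wordOf k x.2 y.2)

theorem block_congr {k : ℕ} {ψ ψ' : Word n → ℂ} (h : ∀ w, w.length = k → ψ w = ψ' w) :
    block k ψ = block k ψ' := by
  ext x y
  exact h _ (length_wordOf k x y)

theorem exists_block_eq : ∀ (k : ℕ) (Y : Matrix (Idx n k) (Idx n k) ℂ), ∃ ψ, block k ψ = Y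
  | 0, Y => ⟨fun _ => Y () (), by ext ⟨⟩ ⟨⟩; rfl⟩
  | k + 1, Y => by
    choose ψ hψ using fun a : Fin n × Fin n =>
      exists_block_eq k (.of fun s t => Y (a.1, s) (a.2, t))
    refine ⟨fun w => match w with | [] => 0 | a :: w => ψ a w, ?_⟩
    ext ⟨i, s⟩ ⟨j, t⟩
    exact congrFun (congrFun (hψ (i, j)) s) t

/-- The invariance of the values of `ψ` on words of length `k` that expresses that `block k ψ`
commutes with the algebra `jones n k`. -/
structure Invariant (k : ℕ) (ψ : Word n → ℂ) : Prop where
  sum : ∀ (w w' : Word n) (i j : Fin n), w.length + w'.length + 1 = k →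
    ∑ a, ψ (w ++ (i, a) :: w') = ∑ a, ψ (w ++ (a, j) :: w')
  orth : ∀ (w w' : Word n) (a b : Fin n × Fin n), w.length + w'.length + 2 = k →
    ¬(a.1 = b.1 ↔ a.2 = b.2) → ψ (w ++ a :: b :: w') = 0

theorem invariant_zero (ψ : Word n → ℂ) : Invariant 0 ψ :=
  ⟨fun _ _ _ _ h => by omega, fun _ _ _ _ h => by omega⟩

theorem invariant_succ_iff (k : ℕ) (ψ : Word n → ℂ) :
    Invariant (k + 1) ψ ↔ (∀ a, Invariant k fun w => ψ (a :: w)) ∧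
      (∀ (w : Word n) (i j : Fin n), w.length = k → ∑ a, ψ ((i, a) :: w) = ∑ a, ψ ((a, j) :: w)) ∧
      ∀ (w : Word n) (a b : Fin n × Fin n), w.length + 1 = k → ¬(a.1 = b.1 ↔ a.2 = b.2) →
        ψ (a :: b :: w) = 0 := by
  constructor
  · intro h
    refine ⟨fun a => ⟨fun w w' i j hw => ?_, fun w w' b c hw hbc => ?_⟩, fun w i j hw => ?_,
      fun w a b hw hab => ?_⟩
    · exact h.sum (a :: w) w' i j (by simp only [List.length_cons]; omega)
    · exact h.orth (a :: w) w' b c (by simp only [List.length_cons]; omega) hbc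
    · exact h.sum [] w i j (by simp only [List.length_nil]; omega)
    · exact h.orth [] w a b (by simp only [List.length_nil]; omega) hab
  · rintro ⟨h1, h2, h3⟩
    refine ⟨fun w w' i j hw => ?_, fun w w' b c hw hbc => ?_⟩
    · cases w with
      | nil => exact h2 w' i j (by simp only [List.length_nil] at hw; omega)
      | cons a w => exact (h1 a).sum w w' i j (by simp only [List.length_cons] at hw; omega)
    · cases w with
      | nil => exact h3 w' b c (by simp only [List.length_nil] at hw; omega) hbc
      | cons a w => exact (h1 a).orth w w' b c (by simp only [List.length_cons] at hw; omega) hbc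

section Commutation

variable {T : Type} [DecidableEq T] [Fintype T] (X : Matrix (Fin n × T) (Fin n × T) ℂ)

theorem commute_sup_adjoin_iff {S : Subalgebra ℂ (Matrix T T ℂ)} {e X : Matrix T T ℂ} :
    (∀ g ∈ S ⊔ Algebra.adjoin ℂ {e}, X * g = g * X) ↔ (∀ g ∈ S, X * g = g * X) ∧ X * e = e * X := by
  refine ⟨fun h => ⟨fun g hg => h g (le_sup_left (a := S) hg),
    h e (le_sup_right (a := S) (Algebra.subset_adjoin rfl))⟩, fun ⟨h1, h2⟩ g hg => ?_⟩
  have hle : S ⊔ Algebra.adjoin ℂ {e} ≤ Subalgebra.centralizer ℂ {X} := by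
    refine sup_le (fun g hg => ?_) (Algebra.adjoin_le ?_)
    · rw [Subalgebra.mem_centralizer_iff]
      rintro _ rfl
      exact h1 g hg
    · rintro _ rfl
      rw [SetLike.mem_coe, Subalgebra.mem_centralizer_iff]
      rintro _ rfl
      exact h2
  exact Subalgebra.mem_centralizer_iff ℂ |>.1 (hle hg) X rfl

theorem commute_amplify_iff (g : Matrix T T ℂ) :
    X * amplify n g = amplify n g * X ↔ ∀ i j, (Matrix.of fun s t => X (i, s) (j, t)) * g =
      g * (Matrix.of fun s t => X (i, s) (j, t)) := by
  constructor
  · intro h i j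
    ext s t
    have := congrFun (congrFun h (i, s)) (j, t)
    simpa [Matrix.mul_apply, Fintype.sum_prod_type, amplify_apply] using this
  · intro h
    ext ⟨i, s⟩ ⟨j, t⟩
    have := congrFun (congrFun (h i j) s) t
    simpa [Matrix.mul_apply, Fintype.sum_prod_type, amplify_apply] using this

theorem commute_cap_cup_iff :
    X * (cap n T * cup n T) = (cap n T * cup n T) * X ↔
      ∀ i j s t, ∑ a, X (i, s) (a, t) = ∑ a, X (a, s) (j, t) := by
  constructor
  · intro h i j s t
    have := congrFun (congrFun h (i, s)) (j, t)
    simpa [Matrix.mul_apply, Fintype.sum_prod_type, cap_apply, cup_apply] using this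
  · intro h
    ext ⟨i, s⟩ ⟨j, t⟩
    have := h i j s t
    simpa [Matrix.mul_apply, Fintype.sum_prod_type, cap_apply, cup_apply] using this

theorem commute_diag_iff (X : Matrix (Fin n × Fin n × T) (Fin n × Fin n × T) ℂ) :
    X * diag n T = diag n T * X ↔
      ∀ i i' j j' s t, ¬(i = i' ↔ j = j') → X (i, i', s) (j, j', t) = 0 := by
  constructor
  · intro h i i' j j' s t hij
    have := congrFun (congrFun h (i, i', s)) (j, j', t)
    rw [diag, Matrix.mul_diagonal, Matrix.diagonal_mul] at this
    by_cases h1 : i = i' <;> by_cases h2 : j = j' <;> simp_all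
  · intro h
    ext ⟨i, i', s⟩ ⟨j, j', t⟩
    rw [diag, Matrix.mul_diagonal, Matrix.diagonal_mul]
    have := h i i' j j' s t
    by_cases h1 : i = i' <;> by_cases h2 : j = j' <;> simp_all

theorem commute_of_mem_bot (X : Matrix T T ℂ) {g : Matrix T T ℂ}
    (hg : g ∈ (⊥ : Subalgebra ℂ (Matrix T T ℂ))) : X * g = g * X := by
  obtain ⟨c, rfl⟩ := Algebra.mem_bot.1 hg
  exact (Algebra.commutes c _).symm

variable {X}

theorem sum_row_of_mul_cap {Z : Matrix T T ℂ} (h : X * cap n T = cap n T * Z) (i : Fin n)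
    (s t : T) : ∑ a, X (i, s) (a, t) = Z s t := by
  have := congrFun (congrFun h (i, s)) t
  simpa [Matrix.mul_apply, Fintype.sum_prod_type, cap_apply] using this

theorem sum_col_of_cup_mul {Z : Matrix T T ℂ} (h : cup n T * X = Z * cup n T) (j : Fin n)
    (s t : T) : ∑ a, X (a, s) (j, t) = Z s t := by
  have := congrFun (congrFun h s) (j, t)
  simpa [Matrix.mul_apply, Fintype.sum_prod_type, cup_apply] using this

end Commutation

/-- The values of `ψ` on the words of length `k` form an operator in the commutant of `jones n k`
exactly if they are invariant. -/
theorem commute_jones_iff : ∀ (k : ℕ) (ψ : Word n → ℂ),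
    (∀ g ∈ jones n k, block k ψ * g = g * block k ψ) ↔ Invariant k ψ
  | 0, ψ => by
    refine ⟨fun _ => invariant_zero ψ, fun _ g hg => ?_⟩
    exact commute_of_mem_bot (block 0 ψ) hg
  | k + 1, ψ => by
    have hamp : (∀ g ∈ (jones n k).map (amplify n), blockSucc k ψ * g = g * blockSucc k ψ) ↔
        ∀ a, Invariant k fun w => ψ (a :: w) := by
      simp only [← commute_jones_iff k]
      constructor
      · intro h a g hg
        exact (commute_amplify_iff _ g).1 (h _ ⟨g, hg, rfl⟩) a.1 a.2
      · rintro h _ ⟨g, hg, rfl⟩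
        exact (commute_amplify_iff _ g).2 fun i j => h (i, j) g hg
    have hcap : blockSucc k ψ * (cap n (Idx n k) * cup n (Idx n k)) =
        (cap n (Idx n k) * cup n (Idx n k)) * blockSucc k ψ ↔
        ∀ (w : Word n) (i j : Fin n), w.length = k →
          ∑ a, ψ ((i, a) :: w) = ∑ a, ψ ((a, j) :: w) := by
      rw [commute_cap_cup_iff]
      constructor
      · rintro h w i j rfl
        obtain ⟨s, t, hst⟩ := exists_wordOf w
        have := h i j s t
        change ∑ a, ψ ((i, a) :: wordOf _ s t) = ∑ a, ψ ((a, j) :: wordOf _ s t) at this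
        rwa [hst] at this
      · intro h i j s t
        exact h (wordOf k s t) i j (length_wordOf k s t)
    rw [invariant_succ_iff, ← hamp, ← hcap]
    refine commute_sup_adjoin_iff.trans ?_
    rw [and_comm (b := ∀ (w : Word n) (a b : Fin n × Fin n), _), ← and_assoc]
    refine and_congr_left' ?_
    match k with
    | 0 =>
      refine ⟨fun h => ⟨fun g hg => h g (map_amplify_le_jonesLower n 0 hg),
        fun w a b hw => by omega⟩, fun _ g hg => ?_⟩
      exact commute_of_mem_bot (blockSucc 0 ψ) hg
    | k + 1 =>
      refine commute_sup_adjoin_iff.trans (and_congr_right' ?_)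
      refine (commute_diag_iff (T := Idx n k) (block (k + 2) ψ)).trans ?_
      constructor
      · rintro h w a b hw hab
        obtain rfl : w.length = k := by omega
        obtain ⟨s, t, hst⟩ := exists_wordOf w
        have := h a.1 b.1 a.2 b.2 s t hab
        change ψ ((a.1, a.2) :: (b.1, b.2) :: wordOf _ s t) = 0 at this
        rwa [hst] at this
      · intro h i i' j j' s t hij
        exact h (wordOf k s t) (i, j) (i', j') (by rw [length_wordOf]) hij

end Blocks

/-- `ψ` is compatible with the defining relations, multiplied by words on both sides, as far as they
only involve words of length at most `k`. -/
structure Compatible (k : ℕ) (ψ : Word n → ℂ) : Prop where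
  row : ∀ (w w' : Word n) (i : Fin n), w.length + w'.length + 1 ≤ k →
    ∑ a, ψ (w ++ (i, a) :: w') = ψ (w ++ w')
  col : ∀ (w w' : Word n) (j : Fin n), w.length + w'.length + 1 ≤ k →
    ∑ a, ψ (w ++ (a, j) :: w') = ψ (w ++ w')
  idem : ∀ (w w' : Word n) (a : Fin n × Fin n), w.length + w'.length + 2 ≤ k →
    ψ (w ++ a :: a :: w') = ψ (w ++ a :: w')
  orth : ∀ (w w' : Word n) (a b : Fin n × Fin n), w.length + w'.length + 2 ≤ k →
    ¬(a.1 = b.1 ↔ a.2 = b.2) → ψ (w ++ a :: b :: w') = 0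

theorem Compatible.mono {k m : ℕ} (h : k ≤ m) {ψ : Word n → ℂ} (hψ : Compatible m ψ) :
    Compatible k ψ :=
  ⟨fun w w' i hw => hψ.row w w' i (hw.trans h), fun w w' i hw => hψ.col w w' i (hw.trans h),
    fun w w' a hw => hψ.idem w w' a (hw.trans h),
    fun w w' a b hw => hψ.orth w w' a b (hw.trans h)⟩

theorem Compatible.invariant {k : ℕ} {ψ : Word n → ℂ} (hψ : Compatible k ψ) : Invariant k ψ :=
  ⟨fun w w' i j hw => by rw [hψ.row w w' i hw.le, hψ.col w w' j hw.le],
    fun w w' a b hw => hψ.orth w w' a b hw.le⟩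

/-- Invariance moves the row and column sum relations from the front of a word to every position.
The remaining relations follow. -/
theorem Invariant.sums {k : ℕ} {ψ : Word n → ℂ} (hψ : Invariant (k + 1) ψ)
    (hrow : ∀ (w : Word n) (i : Fin n), w.length = k → ∑ a, ψ ((i, a) :: w) = ψ w)
    (hcol : ∀ (w : Word n) (j : Fin n), w.length = k → ∑ a, ψ ((a, j) :: w) = ψ w) (w : Word n) :
    ∀ w' : Word n, w.length + w'.length = k →
      (∀ i, ∑ a, ψ (w ++ (i, a) :: w') = ψ (w ++ w')) ∧
      (∀ j, ∑ a, ψ (w ++ (a, j) :: w') = ψ (w ++ w')) := by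
  induction w using List.reverseRecOn with
  | nil =>
    intro w' hw
    have hw' : w'.length = k := by simpa using hw
    exact ⟨fun i => hrow w' i hw', fun j => hcol w' j hw'⟩
  | append_singleton v b ih =>
    intro w' hw
    have hlen : v.length + w'.length + 1 = k := by
      simp only [List.length_append, List.length_singleton] at hw; omega
    -- All terms but one of the row sum at the position in front of `b` vanish.
    have hsq : ψ (v ++ b :: b :: w') = ψ (v ++ b :: w') := by
      rw [← (ih (b :: w') (by simp only [List.length_cons]; omega)).1 b.1,
        Finset.sum_eq_single b.2]
      · intro a _ ha
        exact hψ.orth v w' (b.1, a) b (by omega) (by simpa using ha)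
      · simp
    have hsum (i j : Fin n) :
        ∑ a, ψ (v ++ b :: (i, a) :: w') = ∑ a, ψ (v ++ b :: (a, j) :: w') := by
      simpa using hψ.sum (v ++ [b]) w' i j 
        (by simp only [List.length_append, List.length_singleton]; omega)
    -- By `hsum`, all sums at the position behind `b` agree; this one has a single nonzero term.
    have hcol' : ∑ a, ψ (v ++ b :: (a, b.2) :: w') = ψ (v ++ b :: w') := by
      rw [Finset.sum_eq_single b.1, hsq]
      · intro a _ ha
        exact hψ.orth v w' b (a, b.2) (by omega) (by simpa [eq_comm] using ha)
      · simp
    simp only [List.append_assoc, List.singleton_append]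
    exact ⟨fun i => (hsum i b.2).trans hcol', fun j => (hsum b.1 j).symm.trans
      ((hsum b.1 b.2).trans hcol')⟩

/-- A functional that is compatible with the relations up to length `k` has a modification in
length `k + 1` that is compatible up to length `k + 1`. -/
theorem Compatible.exists_succ {k : ℕ} {φ : Word n → ℂ} (hφ : Compatible k φ) :
    ∃ φ' : Word n → ℂ, (∀ w, w.length ≤ k → φ' w = φ w) ∧ Compatible (k + 1) φ' := by
  have hX := (commute_jones_iff k φ).2 hφ.invariant
  obtain ⟨Y, hY, hYcap, hcupY⟩ := exists_matrix_extension (T := Fin n × Idx n k) (jones n (k + 1))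
    (conjTranspose_mem_jones n (k + 1)) (cap n (Idx n k)) (block k φ) (fun a ha => by
      rw [conjTranspose_cap]
      exact hX _ (compression_jones_mem n k a ha))
  rw [conjTranspose_cap] at hcupY
  obtain ⟨ψ, hψ⟩ := exists_block_eq (k + 1) Y
  let φ' : Word n → ℂ := fun w => if w.length ≤ k then φ w else ψ w
  have hle (w : Word n) (hw : w.length ≤ k) : φ' w = φ w := if_pos hw
  have hblock : block (k + 1) φ' = Y := by
    rw [← hψ]
    exact block_congr fun w hw => if_neg (by omega)
  have hinv : Invariant (k + 1) φ' := by
    rw [← commute_jones_iff, hblock]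
    exact hY
  have hrow (w : Word n) (i : Fin n) (hw : w.length = k) : ∑ a, φ' ((i, a) :: w) = φ' w := by
    subst hw
    rw [hle w le_rfl]
    obtain ⟨s, t, hst⟩ := exists_wordOf w
    have := sum_row_of_mul_cap hYcap i s t
    rw [← hblock] at this
    change ∑ a, φ' ((i, a) :: wordOf _ s t) = φ (wordOf _ s t) at this
    rwa [hst] at this
  have hcol (w : Word n) (j : Fin n) (hw : w.length = k) : ∑ a, φ' ((a, j) :: w) = φ' w := by
    subst hw
    rw [hle w le_rfl]
    obtain ⟨s, t, hst⟩ := exists_wordOf w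
    have := sum_col_of_cup_mul hcupY j s t
    rw [← hblock] at this
    change ∑ a, φ' ((a, j) :: wordOf _ s t) = φ (wordOf _ s t) at this
    rwa [hst] at this
  have hsums := hinv.sums hrow hcol
  refine ⟨φ', hle, ⟨fun w w' i hw => ?_, fun w w' j hw => ?_, fun w w' a hw => ?_,
    fun w w' a b hw hab => ?_⟩⟩
  · obtain hw | hw := hw.lt_or_eq
    · simp only [hle (w ++ w') (by simp only [List.length_append]; omega),
        hle (w ++ (i, _) :: w') (by simp only [List.length_append, List.length_cons]; omega)]
      exact hφ.row w w' i (by omega)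
    · exact (hsums w w' (by omega)).1 i
  · obtain hw | hw := hw.lt_or_eq
    · simp only [hle (w ++ w') (by simp only [List.length_append]; omega),
        hle (w ++ (_, j) :: w') (by simp only [List.length_append, List.length_cons]; omega)]
      exact hφ.col w w' j (by omega)
    · exact (hsums w w' (by omega)).2 j
  · obtain hw | hw := hw.lt_or_eq
    · rw [hle _ (by simp only [List.length_append, List.length_cons]; omega),
        hle _ (by simp only [List.length_append, List.length_cons]; omega)]
      exact hφ.idem w w' a (by omega)
    · rw [← (hsums w (a :: w') (by simp only [List.length_cons]; omega)).1 a.1,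
        Finset.sum_eq_single a.2]
      · intro b _ hb
        exact hinv.orth w w' (a.1, b) a (by omega) (by simpa using hb)
      · simp
  · obtain hw | hw := hw.lt_or_eq
    · rw [hle _ (by simp only [List.length_append, List.length_cons]; omega)]
      exact hφ.orth w w' a b (by omega) hab
    · exact hinv.orth w w' a b hw hab

theorem Compatible.exists_of_le {k : ℕ} {φ : Word n → ℂ} (hφ : Compatible k φ) {m : ℕ}
    (h : k ≤ m) : ∃ φ' : Word n → ℂ, (∀ w, w.length ≤ k → φ' w = φ w) ∧ Compatible m φ' := by
  induction m, h using Nat.le_induction with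
  | base => exact ⟨φ, fun _ _ => rfl, hφ⟩
  | succ m hkm ih =>
    obtain ⟨φ₁, h1, h2⟩ := ih
    obtain ⟨φ₂, h3, h4⟩ := h2.exists_succ
    exact ⟨φ₂, fun w hw => (h3 w (hw.trans hkm)).trans (h1 w hw), h4⟩

/-! ### The basis of words -/

theorem basisFreeMonoid_apply (w : Word n) :
    FreeAlgebra.basisFreeMonoid ℂ (Fin n × Fin n) (FreeMonoid.ofList w) = monomial w := by
  have h : FreeAlgebra.equivMonoidAlgebraFreeMonoid (R := ℂ) (X := Fin n × Fin n) (monomial w) =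
      MonoidAlgebra.single (FreeMonoid.ofList w) 1 := by
    induction w with
    | nil => simp [monomial, MonoidAlgebra.one_def]
    | cons a w ih =>
      have : monomial (a :: w) = u a.1 a.2 * monomial w := by simp [monomial]
      rw [this, map_mul, ih]
      simp [u, FreeAlgebra.equivMonoidAlgebraFreeMonoid, MonoidAlgebra.of_apply,
        MonoidAlgebra.single_mul_single]
  rw [← FreeAlgebra.equivMonoidAlgebraFreeMonoid.symm_apply_apply (monomial w), h]
  simp [FreeAlgebra.basisFreeMonoid]

/-- The linear functional on the free algebra with given values on the words. -/
noncomputable def functional (ψ : Word n → ℂ) : Free n →ₗ[ℂ] ℂ :=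
  (FreeAlgebra.basisFreeMonoid ℂ (Fin n × Fin n)).constr ℂ fun w => ψ (FreeMonoid.toList w)

theorem functional_monomial (ψ : Word n → ℂ) (w : Word n) : functional ψ (monomial w) = ψ w := by
  rw [← basisFreeMonoid_apply, functional, Module.Basis.constr_basis]
  rfl

theorem span_range_monomial : Submodule.span ℂ (Set.range (monomial (n := n))) = ⊤ := by
  rw [← (FreeAlgebra.basisFreeMonoid ℂ (Fin n × Fin n)).span_eq]
  congr 1
  ext x
  exact ⟨fun ⟨w, h⟩ => ⟨FreeMonoid.ofList w, by rw [basisFreeMonoid_apply, h]⟩,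
    fun ⟨w, h⟩ => ⟨w.toList, by rw [← h]; exact (basisFreeMonoid_apply w.toList).symm⟩⟩

theorem monomial_append (w w' : Word n) : monomial (w ++ w') = monomial w * monomial w' := by
  simp [monomial]

/-! ### Signed lists of words -/

/-- A formal sum of words with signs (`true` stands for `1` and `false` for `-1`). Integers are
written in unary, as lists of signs. -/
abbrev SignedSum (n : ℕ) : Type := List (Bool × Word n)

/-- The number `1` or `-1`. -/
def sgn (b : Bool) : ℂ := bif b then 1 else -1

/-- The element of the free algebra denoted by a signed sum. -/
noncomputable def SignedSum.eval (f : SignedSum n) : Free n :=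
  (f.map fun t => sgn t.1 • monomial t.2).sum

/-- The signed sum multiplied by words on both sides. -/
def SignedSum.pad (w w' : Word n) (f : SignedSum n) : SignedSum n :=
  f.map fun t => (t.1, w ++ (t.2 ++ w'))

theorem SignedSum.eval_pad (w w' : Word n) (f : SignedSum n) :
    (f.pad w w').eval = monomial w * f.eval * monomial w' := by
  induction f with
  | nil => simp [eval, pad]
  | cons t f ih =>
    simp only [eval, pad, List.map_cons, List.sum_cons] at ih ⊢
    rw [ih, mul_add, add_mul, monomial_append, monomial_append, mul_smul_comm, smul_mul_assoc]
    simp only [mul_assoc]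

/-- The defining relations as signed sums. -/
def relationList (n : ℕ) : List (SignedSum n) :=
  let I := List.finRange n
  (I.map fun i => (I.map fun a => (true, [(i, a)])) ++ [(false, [])]) ++
    (I.map fun j => (I.map fun a => (true, [(a, j)])) ++ [(false, [])]) ++
    ((I ×ˢ I).map fun a => [(true, [a, a]), (false, [a])]) ++
    (((I ×ˢ I) ×ˢ (I ×ˢ I)).filter fun p => ¬(p.1.1 = p.2.1 ↔ p.1.2 = p.2.2)).map
      fun p => [(true, [p.1, p.2])]

theorem exists_mem_relationList {p : SignedSum n → Prop} : (∃ f ∈ relationList n, p f) ↔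
    (∃ i : Fin n, p (((List.finRange n).map fun a => (true, [(i, a)])) ++ [(false, [])])) ∨
    (∃ j : Fin n, p (((List.finRange n).map fun a => (true, [(a, j)])) ++ [(false, [])])) ∨
    (∃ a, p [(true, [a, a]), (false, [a])]) ∨
    (∃ a b, ¬(a.1 = b.1 ↔ a.2 = b.2) ∧ p [(true, [a, b])]) := by
  simp only [relationList, List.mem_append, List.mem_map, List.mem_finRange, true_and,
    List.mem_filter, decide_eq_true_eq]
  constructor
  · rintro ⟨f, ((⟨i, rfl⟩ | ⟨i, rfl⟩) | ⟨a, -, rfl⟩) | ⟨a, ⟨-, h⟩, rfl⟩, hf⟩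
    · exact Or.inl ⟨i, hf⟩
    · exact Or.inr (Or.inl ⟨i, hf⟩)
    · exact Or.inr (Or.inr (Or.inl ⟨a, hf⟩))
    · exact Or.inr (Or.inr (Or.inr ⟨a.1, a.2, h, hf⟩))
  · rintro (⟨i, h⟩ | ⟨i, h⟩ | ⟨a, h⟩ | ⟨a, b, hab, h⟩)
    · exact ⟨_, Or.inl (Or.inl (Or.inl ⟨i, rfl⟩)), h⟩
    · exact ⟨_, Or.inl (Or.inl (Or.inr ⟨i, rfl⟩)), h⟩
    · exact ⟨_, Or.inl (Or.inr ⟨a, List.mem_product.2 ⟨by simp, by simp⟩, rfl⟩), h⟩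
    · exact ⟨_, Or.inr ⟨(a, b), ⟨List.mem_product.2 ⟨List.mem_product.2 ⟨by simp, by simp⟩,
        List.mem_product.2 ⟨by simp, by simp⟩⟩, hab⟩, rfl⟩, h⟩

theorem eval_row (i : Fin n) :
    SignedSum.eval (((List.finRange n).map fun a => (true, [(i, a)])) ++ [(false, [])]) = rs i := by
  simp [SignedSum.eval, sgn, monomial, rs, Fin.sum_univ_def, Function.comp_def, sub_eq_add_neg]

theorem eval_col (j : Fin n) :
    SignedSum.eval (((List.finRange n).map fun a => (true, [(a, j)])) ++ [(false, [])]) = cs j := by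
  simp [SignedSum.eval, sgn, monomial, cs, Fin.sum_univ_def, Function.comp_def, sub_eq_add_neg]

theorem eval_idem (a : Fin n × Fin n) :
    SignedSum.eval [(true, [a, a]), (false, [a])] = ip a.1 a.2 := by
  simp [SignedSum.eval, sgn, monomial, ip, sub_eq_add_neg, sq]

theorem eval_orth (a b : Fin n × Fin n) :
    SignedSum.eval [(true, [a, b])] = u a.1 a.2 * u b.1 b.2 := by
  simp [SignedSum.eval, sgn, monomial]

theorem mem_relations_iff {r : Free n} :
    r ∈ relations n ↔ ∃ f ∈ relationList n, f.eval = r := by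
  rw [exists_mem_relationList]
  simp only [eval_row, eval_col, eval_idem, eval_orth, relations, Set.mem_ofPred_eq]
  constructor
  · rintro (⟨i, rfl⟩ | ⟨i, rfl⟩ | ⟨i, j, rfl⟩ | ⟨i, j, k, h, rfl⟩ | ⟨i, j, k, h, rfl⟩)
    · exact Or.inl ⟨i, rfl⟩
    · exact Or.inr (Or.inl ⟨i, rfl⟩)
    · exact Or.inr (Or.inr (Or.inl ⟨(i, j), rfl⟩))
    · exact Or.inr (Or.inr (Or.inr ⟨(j, i), (k, i), by simpa using h, rfl⟩))
    · exact Or.inr (Or.inr (Or.inr ⟨(i, k), (i, j), by simpa [eq_comm] using h, rfl⟩))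
  · rintro (⟨i, rfl⟩ | ⟨i, rfl⟩ | ⟨a, rfl⟩ | ⟨a, b, h, rfl⟩)
    · exact Or.inl ⟨i, rfl⟩
    · exact Or.inr (Or.inl ⟨i, rfl⟩)
    · exact Or.inr (Or.inr (Or.inl ⟨a.1, a.2, rfl⟩))
    · obtain ⟨a, a'⟩ := a
      obtain ⟨b, b'⟩ := b
      by_cases hab : a = b
      · subst hab
        exact Or.inr (Or.inr (Or.inr (Or.inr ⟨a, b', a', by simpa [eq_comm] using h, rfl⟩)))
      · obtain rfl : a' = b' := by
          by_contra h'
          simp [hab, h'] at h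
        exact Or.inr (Or.inr (Or.inr (Or.inl ⟨a', a, b, hab, rfl⟩)))

/-! ### Ideal membership by linear algebra -/

/-- Vanishing on the padded relations, in terms of `Compatible`. -/
theorem functional_pad_eq_zero_iff (ψ : Word n → ℂ) (w w' : Word n) :
    (∀ f ∈ relationList n, functional ψ (f.pad w w').eval = 0) ↔
      (∀ i, ∑ a, ψ (w ++ (i, a) :: w') = ψ (w ++ w')) ∧
      (∀ j, ∑ a, ψ (w ++ (a, j) :: w') = ψ (w ++ w')) ∧
      (∀ a, ψ (w ++ a :: a :: w') = ψ (w ++ a :: w')) ∧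
      (∀ a b, ¬(a.1 = b.1 ↔ a.2 = b.2) → ψ (w ++ a :: b :: w') = 0) := by
  have h (f : SignedSum n) : functional ψ (f.pad w w').eval =
      (f.map fun t => sgn t.1 * ψ (w ++ (t.2 ++ w'))).sum := by
    induction f with
    | nil => simp [SignedSum.eval, SignedSum.pad]
    | cons t f ih =>
      simp only [SignedSum.eval, SignedSum.pad, List.map_cons, List.sum_cons] at ih ⊢
      rw [map_add, ih, map_smul, functional_monomial, smul_eq_mul]
  have := not_congr (exists_mem_relationList (n := n)
    (p := fun f => functional ψ (f.pad w w').eval ≠ 0))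
  simp only [not_exists, not_and, not_or, not_not, ne_eq] at this
  rw [this]
  simp [h, sgn, Fin.sum_univ_def, Function.comp_def, ← sub_eq_add_neg, sub_eq_zero]

theorem compatible_of_functional {k : ℕ} {ψ : Word n → ℂ}
    (h : ∀ w w' : Word n, w.length ≤ k → w'.length ≤ k → ∀ f ∈ relationList n,
      functional ψ (f.pad w w').eval = 0) : Compatible k ψ := by
  simp only [functional_pad_eq_zero_iff] at h
  exact ⟨fun w w' i hw => (h w w' (by omega) (by omega)).1 i,
    fun w w' i hw => (h w w' (by omega) (by omega)).2.1 i,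
    fun w w' i hw => (h w w' (by omega) (by omega)).2.2.1 i,
    fun w w' a b hw => (h w w' (by omega) (by omega)).2.2.2 a b⟩

theorem Compatible.functional_pad {k : ℕ} {ψ : Word n → ℂ} (hψ : Compatible k ψ) {w w' : Word n}
    (hw : w.length + w'.length + 2 ≤ k) {f : SignedSum n} (hf : f ∈ relationList n) :
    functional ψ (f.pad w w').eval = 0 := by
  revert f
  rw [functional_pad_eq_zero_iff]
  exact ⟨fun i => hψ.row w w' i (by omega), fun i => hψ.col w w' i (by omega),
    fun a => hψ.idem w w' a hw, fun a b => hψ.orth w w' a b hw⟩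

/-- An element of the ideal is annihilated by all functionals that are compatible with the relations
up to some length. -/
theorem exists_forall_compatible {x : Free n} (hx : x ∈ idealQS n) :
    ∃ m, ∀ ψ, Compatible m ψ → functional ψ x = 0 := by
  have mem_add {x y : Free n} : (∃ m, ∀ ψ, Compatible m ψ → functional ψ x = 0) →
      (∃ m, ∀ ψ, Compatible m ψ → functional ψ y = 0) →
      ∃ m, ∀ ψ, Compatible m ψ → functional ψ (x + y) = 0 := by
    rintro ⟨m, hm⟩ ⟨m', hm'⟩
    refine ⟨max m m', fun ψ hψ => ?_⟩
    rw [map_add, hm ψ (hψ.mono (le_max_left _ _)), hm' ψ (hψ.mono (le_max_right _ _)), add_zero]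
  rw [idealQS, TwoSidedIdeal.mem_span_iff_mem_addSubgroup_closure] at hx
  induction hx using AddSubgroup.closure_induction with
  | zero => exact ⟨0, fun ψ _ => map_zero _⟩
  | add x y _ _ hx hy => exact mem_add hx hy
  | neg x _ hx =>
    obtain ⟨m, hm⟩ := hx
    exact ⟨m, fun ψ hψ => by rw [map_neg, hm ψ hψ, neg_zero]⟩
  | mem x hx =>
    obtain ⟨_, ⟨a, -, r, hr, rfl⟩, b, -, rfl⟩ := hx
    obtain ⟨f, hf, rfl⟩ := mem_relations_iff.1 hr
    change ∃ m, ∀ ψ, Compatible m ψ → functional ψ (a * f.eval * b) = 0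
    have ha : a ∈ Submodule.span ℂ (Set.range (monomial (n := n))) := by
      rw [span_range_monomial]; trivial
    have hb : b ∈ Submodule.span ℂ (Set.range (monomial (n := n))) := by
      rw [span_range_monomial]; trivial
    induction ha using Submodule.span_induction with
    | zero => exact ⟨0, fun ψ _ => by rw [zero_mul, zero_mul, map_zero]⟩
    | add x y _ _ hx hy => rw [add_mul, add_mul]; exact mem_add hx hy
    | smul c x _ hx =>
      obtain ⟨m, hm⟩ := hx
      exact ⟨m, fun ψ hψ => by
        rw [smul_mul_assoc, smul_mul_assoc, map_smul, hm ψ hψ, smul_zero]⟩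
    | mem x hx =>
      obtain ⟨w, rfl⟩ := hx
      induction hb using Submodule.span_induction with
      | zero => exact ⟨0, fun ψ _ => by rw [mul_zero, map_zero]⟩
      | add x y _ _ hx hy => rw [mul_add]; exact mem_add hx hy
      | smul c x _ hx =>
        obtain ⟨m, hm⟩ := hx
        exact ⟨m, fun ψ hψ => by rw [mul_smul_comm, map_smul, hm ψ hψ, smul_zero]⟩
      | mem x hx =>
        obtain ⟨w', rfl⟩ := hx
        exact ⟨w.length + w'.length + 2, fun ψ hψ => by
          rw [← SignedSum.eval_pad]; exact hψ.functional_pad le_rfl hf⟩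

/-- The relations multiplied by words of length at most `k` on both sides. -/
def paddedRelations (n k : ℕ) : Set (SignedSum n) :=
  {g | ∃ w w' : Word n, w.length ≤ k ∧ w'.length ≤ k ∧ ∃ f ∈ relationList n, f.pad w w' = g}

/-- A combination of words of length at most `k` lies in the ideal exactly if it is a linear
combination of the finitely many relations multiplied by words of length at most `k`. -/
theorem mem_idealQS_iff {k : ℕ} {x : Free n}
    (hx : x ∈ Submodule.span ℂ (monomial '' {w : Word n | w.length ≤ k})) :
    x ∈ idealQS n ↔ x ∈ Submodule.span ℂ (SignedSum.eval '' paddedRelations n k) := by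
  constructor
  · intro h
    by_contra hspan
    obtain ⟨φ, hφx, hφ⟩ := Submodule.exists_le_ker_of_notMem hspan
    set ψ : Word n → ℂ := fun w => φ (monomial w) with hψ
    have hfun : functional ψ = φ := by
      refine LinearMap.ext_on_range span_range_monomial fun w => ?_
      rw [functional_monomial]
    have hcomp : Compatible k ψ := by
      refine compatible_of_functional fun w w' hw hw' f hf => ?_
      rw [hfun]
      exact hφ (Submodule.subset_span ⟨_, ⟨w, w', hw, hw', f, hf, rfl⟩, rfl⟩)
    obtain ⟨m, hm⟩ := exists_forall_compatible h
    obtain ⟨ψ', h1, h2⟩ := hcomp.exists_of_le (le_max_left k m)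
    have hzero := hm ψ' (h2.mono (le_max_right k m))
    have hagree : functional ψ' x = functional ψ x := by
      have : Set.EqOn (functional ψ') (functional ψ) (monomial '' {w : Word n | w.length ≤ k}) := by
        rintro _ ⟨w, hw, rfl⟩
        rw [functional_monomial, functional_monomial, h1 w hw]
      exact LinearMap.eqOn_span this hx
    rw [hagree, hfun] at hzero
    exact hφx hzero
  · clear hx
    intro h
    induction h using Submodule.span_induction with
    | zero => exact (idealQS n).zero_mem
    | add x y _ _ hx hy => exact (idealQS n).add_mem hx hy
    | smul c x _ hx => rw [Algebra.smul_def]; exact (idealQS n).mul_mem_left _ _ hx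
    | mem x hx =>
      obtain ⟨_, ⟨w, w', -, -, f, hf, rfl⟩, rfl⟩ := hx
      rw [SignedSum.eval_pad]
      exact (idealQS n).mul_mem_right _ _ ((idealQS n).mul_mem_left _ _
        (TwoSidedIdeal.subset_span (mem_relations_iff.2 ⟨f, hf, rfl⟩)))

/-! ### Fraction-free elimination -/

/-- The integer denoted by a list of signs. -/
def total (l : List Bool) : ℂ := (l.map sgn).sum

/-- Whether a list of signs denotes `0`. -/
def balanced (l : List Bool) : Bool :=
  (l.filter (· = true)).length = (l.filter (· = false)).length

theorem total_append (l l' : List Bool) : total (l ++ l') = total l + total l' := by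
  simp [total]

theorem total_cons (b : Bool) (l : List Bool) : total (b :: l) = sgn b + total l := by
  simp [total]

theorem balanced_iff (l : List Bool) : balanced l = true ↔ total l = 0 := by
  have h : total l = (l.filter (· = true)).length - (l.filter (· = false)).length := by
    induction l with
    | nil => simp [total]
    | cons b l ih => cases b <;> simp [total_cons, ih, sgn] <;> ring
  rw [h, sub_eq_zero, balanced, decide_eq_true_eq, Nat.cast_inj]

theorem sgn_beq (b c : Bool) : sgn (b == c) = sgn b * sgn c := by
  cases b <;> cases c <;> simp [sgn]

theorem sgn_not (b : Bool) : sgn (!b) = -sgn b := by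
  cases b <;> simp [sgn]

theorem total_map_not (l : List Bool) : total (l.map fun b => !b) = -total l := by
  induction l with
  | nil => simp [total]
  | cons b l ih => rw [List.map_cons, total_cons, total_cons, ih, sgn_not]; ring

namespace SignedSum

/-- The value of `ρ`, as a combination of coordinate functionals, on the word `w`. -/
def coeffAt (ρ : SignedSum n) (w : Word n) : ℂ :=
  (ρ.map fun s => if s.2 = w then sgn s.1 else 0).sum

/-- A signed sum, read as an integral combination of coordinate functionals of the basis of
words. -/
noncomputable def act (ρ : SignedSum n) : Free n →ₗ[ℂ] ℂ := functional ρ.coeffAt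

/-- The value of the functional `ρ` at `f`, as a list of signs. -/
def pair (ρ f : SignedSum n) : List Bool :=
  ρ.flatMap fun s => f.flatMap fun t => if s.2 = t.2 then [s.1 == t.1] else []

/-- The product of an integer and a signed sum. -/
def scale (l : List Bool) (ρ : SignedSum n) : SignedSum n :=
  l.flatMap fun b => ρ.map fun s => (b == s.1, s.2)

theorem coeffAt_append (ρ σ : SignedSum n) (w : Word n) :
    coeffAt (ρ ++ σ) w = ρ.coeffAt w + σ.coeffAt w := by
  simp [coeffAt]

theorem coeffAt_scale (l : List Bool) (ρ : SignedSum n) (w : Word n) :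
    (scale l ρ).coeffAt w = total l * ρ.coeffAt w := by
  induction l with
  | nil => simp [scale, coeffAt, total]
  | cons b l ih =>
    have h : coeffAt (ρ.map fun s => (b == s.1, s.2)) w = sgn b * ρ.coeffAt w := by
      clear ih
      induction ρ with
      | nil => simp [coeffAt]
      | cons s ρ ihρ =>
        simp only [coeffAt, List.map_cons, List.sum_cons, List.map_map] at ihρ ⊢
        rw [mul_add, ← ihρ, sgn_beq, mul_ite, mul_zero]
    have : scale (b :: l) ρ = (ρ.map fun s => (b == s.1, s.2)) ++ scale l ρ := rfl
    rw [this, coeffAt_append, ih, h, total_cons, add_mul]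

theorem functional_add (ψ ψ' : Word n → ℂ) :
    functional (fun w => ψ w + ψ' w) = functional ψ + functional ψ' :=
  LinearMap.ext_on_range span_range_monomial fun w => by simp [functional_monomial]

theorem functional_smul (c : ℂ) (ψ : Word n → ℂ) :
    functional (fun w => c * ψ w) = c • functional ψ :=
  LinearMap.ext_on_range span_range_monomial fun w => by simp [functional_monomial]

theorem act_append (ρ σ : SignedSum n) : act (ρ ++ σ) = ρ.act + σ.act := by
  simp only [act, ← functional_add, ← coeffAt_append]

theorem act_scale (l : List Bool) (ρ : SignedSum n) : (scale l ρ).act = total l • ρ.act := by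
  simp only [act, ← functional_smul, ← coeffAt_scale]

theorem act_monomial (ρ : SignedSum n) (w : Word n) : ρ.act (monomial w) = ρ.coeffAt w :=
  functional_monomial _ _

theorem eval_cons (t : Bool × Word n) (f : SignedSum n) :
    eval (t :: f) = sgn t.1 • monomial t.2 + eval f := by
  simp [eval]

theorem total_pair (ρ f : SignedSum n) : total (pair ρ f) = ρ.act f.eval := by
  have h (s : Bool × Word n) : total (f.flatMap fun t => if s.2 = t.2 then [s.1 == t.1] else []) =
      act [s] f.eval := by
    induction f with
    | nil => simp [total, eval]
    | cons t f ih =>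
      rw [List.flatMap_cons, total_append, ih, eval_cons, map_add, map_smul, act_monomial]
      by_cases h : s.2 = t.2 <;> simp [h, total, sgn_beq, coeffAt, mul_comm]
  induction ρ with
  | nil =>
    have h0 : act ([] : SignedSum n) = 0 :=
      LinearMap.ext_on_range span_range_monomial fun w => by simp [act_monomial, coeffAt]
    rw [h0]
    simp [pair, total]
  | cons s ρ ih =>
    have : pair (s :: ρ) f =
        (f.flatMap fun t => if s.2 = t.2 then [s.1 == t.1] else []) ++ pair ρ f := rfl
    rw [this, total_append, ih, h, ← LinearMap.add_apply, ← act_append, List.singleton_append]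

end SignedSum

/-- One step of the elimination: integral combinations of the functionals in `M` that vanish at `f`.
Instead of choosing a pivot, all pairs of functionals are combined; the functionals that vanish at
`f` already are kept, as the combinations are all zero if there are no others. -/
def eliminateOne (M : List (SignedSum n)) (f : SignedSum n) : List (SignedSum n) :=
  M.flatMap fun ρ => (bif balanced (ρ.pair f) then [ρ] else []) ++ M.map fun σ =>
    SignedSum.scale (σ.pair f) ρ ++ SignedSum.scale ((ρ.pair f).map fun b => !b) σ

/-- The common kernel of functionals. -/
noncomputable def commonKer (M : List (SignedSum n)) : Submodule ℂ (Free n) :=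
  ⨅ ρ ∈ M, ρ.act.ker

theorem mem_commonKer {M : List (SignedSum n)} {x : Free n} :
    x ∈ commonKer M ↔ ∀ ρ ∈ M, ρ.act x = 0 := by
  simp [commonKer]

theorem mem_commonKer_eliminateOne {M : List (SignedSum n)} {f : SignedSum n} {x : Free n} :
    x ∈ commonKer (eliminateOne M f) ↔ ∃ c : ℂ, x - c • f.eval ∈ commonKer M := by
  have key : x ∈ commonKer (eliminateOne M f) ↔ ∀ ρ ∈ M, (ρ.act f.eval = 0 → ρ.act x = 0) ∧
      ∀ σ ∈ M, σ.act f.eval * ρ.act x = ρ.act f.eval * σ.act x := by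
    simp only [mem_commonKer, eliminateOne, List.mem_flatMap, List.mem_append, List.mem_map]
    constructor
    · intro h ρ hρ
      refine ⟨fun h0 => h ρ ⟨ρ, hρ, Or.inl ?_⟩, fun σ hσ => ?_⟩
      · rw [← SignedSum.total_pair, ← balanced_iff] at h0
        simp [h0]
      · have := h _ ⟨ρ, hρ, Or.inr ⟨σ, hσ, rfl⟩⟩
        simpa [SignedSum.act_append, SignedSum.act_scale, total_map_not, SignedSum.total_pair,
          ← sub_eq_add_neg, sub_eq_zero] using this
    · rintro h τ ⟨ρ, hρ, hτ | ⟨σ, hσ, rfl⟩⟩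
      · cases hb : balanced (ρ.pair f) with
        | false => simp [hb] at hτ
        | true =>
          rw [balanced_iff, SignedSum.total_pair] at hb
          simp only [(balanced_iff (ρ.pair f)).2 ((SignedSum.total_pair ρ f).trans hb), cond_true,
            List.mem_singleton] at hτ
          exact hτ ▸ (h ρ hρ).1 hb
      · have := (h ρ hρ).2 σ hσ
        simpa [SignedSum.act_append, SignedSum.act_scale, total_map_not, SignedSum.total_pair,
          ← sub_eq_add_neg, sub_eq_zero] using this
  rw [key]
  constructor
  · intro h
    by_cases h0 : ∀ ρ ∈ M, ρ.act f.eval = 0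
    · exact ⟨0, mem_commonKer.2 fun ρ hρ => by simpa using (h ρ hρ).1 (h0 ρ hρ)⟩
    · push Not at h0
      obtain ⟨σ, hσ, hne⟩ := h0
      refine ⟨σ.act x / σ.act f.eval, mem_commonKer.2 fun ρ hρ => ?_⟩
      have := (h ρ hρ).2 σ hσ
      rw [map_sub, map_smul, smul_eq_mul]
      field_simp
      linear_combination this
  · rintro ⟨c, hc⟩ ρ hρ
    have h1 (τ : SignedSum n) (hτ : τ ∈ M) : τ.act x = c * τ.act f.eval := by
      have := mem_commonKer.1 hc τ hτ
      rwa [map_sub, map_smul, smul_eq_mul, sub_eq_zero] at this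
    exact ⟨fun h0 => by rw [h1 ρ hρ, h0, mul_zero], fun σ hσ => by rw [h1 ρ hρ, h1 σ hσ]; ring⟩

/-- Fraction-free elimination enlarges the common kernel by the span of the eliminated elements. -/
theorem mem_commonKer_foldl {L M : List (SignedSum n)} {x : Free n} :
    x ∈ commonKer (L.foldl eliminateOne M) ↔
      ∃ y ∈ Submodule.span ℂ (SignedSum.eval '' {f | f ∈ L}), x - y ∈ commonKer M := by
  induction L generalizing M x with
  | nil => simp
  | cons f L ih =>
    have hset : SignedSum.eval '' {g | g ∈ f :: L} =
        insert f.eval (SignedSum.eval '' {g | g ∈ L}) := by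
      rw [← Set.image_insert_eq]
      congr 1
      ext g
      simp
    rw [List.foldl_cons, ih]
    simp only [mem_commonKer_eliminateOne, hset]
    constructor
    · rintro ⟨y, hy, c, hc⟩
      refine ⟨c • f.eval + y, Submodule.mem_span_insert.2 ⟨c, y, hy, rfl⟩, ?_⟩
      rwa [← sub_sub, sub_right_comm]
    · rintro ⟨z, hz, hx⟩
      obtain ⟨c, y, hy, rfl⟩ := Submodule.mem_span_insert.1 hz
      refine ⟨y, hy, c, ?_⟩
      rwa [← sub_sub, sub_right_comm] at hx

/-- The words of length at most `k`. -/
def wordsUpTo (n : ℕ) : ℕ → List (Word n)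
  | 0 => [[]]
  | k + 1 => [] :: (wordsUpTo n k).flatMap fun w =>
      (List.finRange n ×ˢ List.finRange n).map fun a => a :: w

theorem mem_wordsUpTo {k : ℕ} {w : Word n} : w ∈ wordsUpTo n k ↔ w.length ≤ k := by
  induction k generalizing w with
  | zero => simp [wordsUpTo]
  | succ k ih =>
    cases w with
    | nil => simp [wordsUpTo]
    | cons a w =>
      simp only [wordsUpTo, List.mem_cons, reduceCtorEq, List.mem_flatMap, List.mem_map,
        List.cons.injEq, false_or, List.length_cons, Nat.add_le_add_iff_right, ← ih]
      exact ⟨fun ⟨v, hv, b, _, _, h⟩ => h ▸ hv, fun h => ⟨w, h, a,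
        List.mem_product.2 ⟨by simp, by simp⟩, rfl, rfl⟩⟩

/-- The elements of `paddedRelations n k`. -/
def paddedList (n k : ℕ) : List (SignedSum n) :=
  (wordsUpTo n k).flatMap fun w => (wordsUpTo n k).flatMap fun w' =>
    (relationList n).map fun f => f.pad w w'

theorem setOf_mem_paddedList (k : ℕ) : {f | f ∈ paddedList n k} = paddedRelations n k := by
  ext g
  simp only [paddedList, paddedRelations, List.mem_flatMap, List.mem_map, mem_wordsUpTo,
    Set.mem_ofPred_eq]
  exact ⟨fun ⟨w, hw, w', hw', h⟩ => ⟨w, w', hw, hw', h⟩, fun ⟨w, w', hw, hw', h⟩ =>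
    ⟨w, hw, w', hw', h⟩⟩

/-- Integral functionals that decide, for combinations of the words `ws`, membership in the ideal.
The elimination starts with the coordinates of all words that occur in `ws` or in the padded
relations; repetitions are harmless. The total length of `ws` serves as a bound for the length of
its words. -/
def membershipTests (ws : List (Word n)) : List (SignedSum n) :=
  (paddedList n ws.flatten.length).foldl eliminateOne
    ((ws ++ (paddedList n ws.flatten.length).flatten.map Prod.snd).map fun w => [(true, w)])

theorem eq_zero_of_coordinates {W : List (Word n)} {z : Free n}
    (hz : z ∈ Submodule.span ℂ (monomial '' {w | w ∈ W}))
    (h : z ∈ commonKer (W.map fun w => [(true, w)])) : z = 0 := by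
  set b := FreeAlgebra.basisFreeMonoid ℂ (Fin n × Fin n) with hb
  have hset : monomial '' {w | w ∈ W} = b '' (FreeMonoid.toList ⁻¹' {w | w ∈ W}) := by
    ext x
    constructor
    · rintro ⟨w, hw, rfl⟩
      exact ⟨FreeMonoid.ofList w, hw, basisFreeMonoid_apply w⟩
    · rintro ⟨w, hw, rfl⟩
      exact ⟨w.toList, hw, (basisFreeMonoid_apply w.toList).symm⟩
  rw [hset, b.mem_span_image] at hz
  have hcoord (w : Word n) : SignedSum.act [(true, w)] z = b.repr z (FreeMonoid.ofList w) := by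
    have : SignedSum.act [(true, w)] = b.coord (FreeMonoid.ofList w) := by
      refine LinearMap.ext_on_range span_range_monomial fun v => ?_
      rw [SignedSum.act_monomial, ← basisFreeMonoid_apply, Module.Basis.coord_apply,
        Module.Basis.repr_self]
      by_cases hvw : w = v
      · subst hvw
        simp [SignedSum.coeffAt, sgn]
      · have hvw' : FreeMonoid.ofList v ≠ FreeMonoid.ofList w := fun h => hvw h.symm
        simp [SignedSum.coeffAt, hvw, Finsupp.single_eq_of_ne' hvw']
    rw [this, Module.Basis.coord_apply]
  rw [← b.repr.map_eq_zero_iff]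
  ext w
  by_contra hw
  have hmem := hz (Finsupp.mem_support_iff.2 hw)
  exact hw ((hcoord w.toList).symm.trans
    (mem_commonKer.1 h _ (List.mem_map.2 ⟨w.toList, hmem, rfl⟩)))

theorem mem_idealQS_iff_membershipTests {ws : List (Word n)} {x : Free n}
    (hx : x ∈ Submodule.span ℂ (monomial '' {w | w ∈ ws})) :
    x ∈ idealQS n ↔ ∀ ρ ∈ membershipTests ws, ρ.act x = 0 := by
  set k := ws.flatten.length with hk
  have hle : ∀ w ∈ ws, w.length ≤ k := fun w hw => by
    rw [hk, List.length_flatten]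
    exact List.single_le_sum (by simp) _ (List.mem_map_of_mem hw)
  rw [mem_idealQS_iff (k := k) (Submodule.span_mono (Set.image_mono hle) hx), ← mem_commonKer,
    membershipTests, mem_commonKer_foldl, setOf_mem_paddedList]
  constructor
  · intro h
    exact ⟨x, h, by rw [sub_self]; exact zero_mem _⟩
  · rintro ⟨y, hy, hxy⟩
    have hmono {f : SignedSum n} {W : List (Word n)} (hf : ∀ t ∈ f, t.2 ∈ W) :
        f.eval ∈ Submodule.span ℂ (monomial '' {w | w ∈ W}) := by
      induction f with
      | nil => exact zero_mem _
      | cons t f ih =>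
        rw [SignedSum.eval_cons]
        exact add_mem (Submodule.smul_mem _ _ (Submodule.subset_span
          ⟨_, hf t List.mem_cons_self, rfl⟩)) (ih fun s hs => hf s (List.mem_cons_of_mem _ hs))
    set W := ws ++ (paddedList n k).flatten.map Prod.snd
    have hyW : y ∈ Submodule.span ℂ (monomial '' {w | w ∈ W}) := by
      refine Submodule.span_le.2 ?_ hy
      rintro _ ⟨f, hf, rfl⟩
      rw [← setOf_mem_paddedList] at hf
      exact hmono fun t ht => List.mem_append_right _ (List.mem_map.2
        ⟨t, List.mem_flatten.2 ⟨f, hf, ht⟩, rfl⟩)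
    have hxW : x ∈ Submodule.span ℂ (monomial '' {w | w ∈ W}) :=
      Submodule.span_mono (Set.image_mono fun w hw => List.mem_append_left _ hw) hx
    have hz := eq_zero_of_coordinates (sub_mem hxW hyW) hxy
    rw [sub_eq_zero] at hz
    rwa [hz]

/-! ### Arithmetic programs -/

section Run

variable (P : List Instr) (x : List ℂ)

theorem run_append (Q : List Instr) :
    run (P ++ Q) x = Q.foldl (fun r s => r ++ [s.exec r]) (run P x) := by
  rw [run, List.foldl_append, run]

theorem run_concat (s : Instr) : run (P ++ [s]) x = run P x ++ [s.exec (run P x)] := by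
  rw [run_append]; rfl

theorem length_run : (run P x).length = x.length + P.length := by
  induction P using List.reverseRecOn with
  | nil => simp [run]
  | append_singleton P s ih => rw [run_concat]; simp [ih, add_assoc]

/-- Earlier registers are not overwritten. -/
theorem getD_run_append (Q : List Instr) {i : ℕ} (hi : i < x.length + P.length) :
    (run (P ++ Q) x).getD i 0 = (run P x).getD i 0 := by
  induction Q using List.reverseRecOn with
  | nil => rw [List.append_nil]
  | append_singleton Q s ih =>
    rw [← List.append_assoc, run_concat, List.getD_append _ _ _ _ (by
      rw [length_run, List.length_append]; omega), ih]

theorem getD_run_input {i : ℕ} (hi : i < x.length) : (run P x).getD i 0 = x.getD i 0 :=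
  getD_run_append [] x P (by simpa using hi)

/-- The value of the last register after a run. -/
noncomputable def output : ℂ := (run P x).getLastD 0

theorem getD_run_last : (run P x).getD (x.length + P.length - 1) 0 = output P x := by
  rw [← length_run, output]
  cases h : run P x using List.reverseRecOn with
  | nil => simp
  | append_singleton r a => simp

theorem output_concat (s : Instr) : output (P ++ [s]) x = s.exec (run P x) := by
  rw [output, run_concat]; simp

end Run

/-- Append to a program the addition or subtraction of the input register `o.2` to the last register
(`m` is the number of inputs). -/
def addTerm (m : ℕ) (P : List Instr) (o : Bool × ℕ) : List Instr :=
  P ++ [bif o.1 then .add (m + P.length - 1) o.2 else .sub (m + P.length - 1) o.2]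

/-- Append to a program the test that the linear form `ops` vanishes, and multiply the previous
output by the outcome. -/
def addTest (m : ℕ) (P : List Instr) (ops : List (Bool × ℕ)) : List Instr :=
  let Q := ops.foldl (addTerm m) (P ++ [.sub 0 0])
  Q ++ [.isZero (m + Q.length - 1)] ++ [.mul (m + Q.length) (m + P.length - 1)]

/-- The program that tests whether all the given linear forms in `m` inputs vanish. -/
def compile (m : ℕ) (tests : List (List (Bool × ℕ))) : List Instr :=
  tests.foldl (addTest m) [.one]

/-- The value of a linear form with integral coefficients. -/
noncomputable def linearForm (ops : List (Bool × ℕ)) (x : List ℂ) : ℂ :=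
  (ops.map fun o => sgn o.1 * x.getD o.2 0).sum

theorem output_foldl_addTerm (x : List ℂ) (ops : List (Bool × ℕ)) (h : ∀ o ∈ ops, o.2 < x.length)
    (P : List Instr) : (∃ R, ops.foldl (addTerm x.length) P = P ++ R) ∧
      output (ops.foldl (addTerm x.length) P) x = output P x + linearForm ops x := by
  induction ops generalizing P with
  | nil => exact ⟨⟨[], by simp⟩, by simp [linearForm]⟩
  | cons o ops ih =>
    obtain ⟨⟨R, hR⟩, hval⟩ := ih (fun o ho => h o (List.mem_cons_of_mem _ ho))
      (addTerm x.length P o)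
    refine ⟨⟨_, by rw [List.foldl_cons, hR, addTerm, List.append_assoc]⟩, ?_⟩
    have ho := getD_run_input P x (h o List.mem_cons_self)
    have hstep : output (addTerm x.length P o) x = output P x + sgn o.1 * x.getD o.2 0 := by
      rw [addTerm, output_concat]
      obtain ⟨b, i⟩ := o
      cases b <;>
        simp only [cond_true, cond_false, Instr.exec, getD_run_last, ho, sgn] <;> ring
    rw [List.foldl_cons, hval, hstep, linearForm, linearForm, List.map_cons, List.sum_cons]
    ring

theorem output_addTest (x : List ℂ) (ops : List (Bool × ℕ)) (h : ∀ o ∈ ops, o.2 < x.length)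
    {P : List Instr} (hP : P ≠ []) : addTest x.length P ops ≠ [] ∧
      (output (addTest x.length P ops) x = 1 ↔ linearForm ops x = 0 ∧ output P x = 1) := by
  refine ⟨by simp [addTest], ?_⟩
  obtain ⟨⟨R, hR⟩, hval⟩ := output_foldl_addTerm x ops h (P ++ [.sub 0 0])
  have hsub : output (P ++ [.sub 0 0]) x = 0 := by rw [output_concat]; simp [Instr.exec]
  rw [hsub, zero_add] at hval
  set Q := ops.foldl (addTerm x.length) (P ++ [.sub 0 0]) with hQ
  have hlen : 0 < P.length := List.length_pos_iff.2 hP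
  have hprev : (run (Q ++ [.isZero (x.length + Q.length - 1)]) x).getD (x.length + P.length - 1) 0 =
      output P x := by
    rw [hR, List.append_assoc, List.append_assoc, getD_run_append _ _ _ (by omega), getD_run_last]
  have htest : (run (Q ++ [.isZero (x.length + Q.length - 1)]) x).getD (x.length + Q.length) 0 =
      Instr.exec (run Q x) (.isZero (x.length + Q.length - 1)) := by
    rw [← output_concat, ← getD_run_last, List.length_append]
    rfl
  have hout : output (addTest x.length P ops) x =
      Instr.exec (run Q x) (.isZero (x.length + Q.length - 1)) * output P x := by
    rw [addTest, ← hQ, output_concat, Instr.exec, hprev, htest]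
  rw [hout, Instr.exec, getD_run_last, hval]
  split_ifs with h0 <;> simp [h0]

theorem accepts_compile_iff (x : List ℂ) (tests : List (List (Bool × ℕ)))
    (h : ∀ ops ∈ tests, ∀ o ∈ ops, o.2 < x.length) :
    Accepts (compile x.length tests) x ↔ ∀ ops ∈ tests, linearForm ops x = 0 := by
  suffices H : ∀ P : List Instr, P ≠ [] → (output (tests.foldl (addTest x.length) P) x = 1 ↔
      (∀ ops ∈ tests, linearForm ops x = 0) ∧ output P x = 1) by
    have hone : output [.one] x = 1 := by
      rw [← List.nil_append [Instr.one], output_concat]; rfl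
    exact (H [.one] (by simp)).trans (by simp [hone])
  induction tests with
  | nil => simp
  | cons ops tests ih =>
    intro P hP
    obtain ⟨h1, h2⟩ := output_addTest x ops (h ops List.mem_cons_self) hP
    rw [List.foldl_cons, ih (fun o ho => h o (List.mem_cons_of_mem _ ho)) _ h1, h2,
      List.forall_mem_cons]
    tauto

/-- The linear form in the coefficients of the signed words `ws` given by the functional `ρ`. -/
def testForm (ws ρ : SignedSum n) : List (Bool × ℕ) :=
  (List.range ws.length).flatMap fun i =>
    (ws[i]?).toList.flatMap fun t => (ρ.pair [t]).map fun b => (b, i)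

/-- The combination of the signed words `ws` with coefficients `x`. -/
noncomputable def combination (ws : SignedSum n) (x : List ℂ) : Free n :=
  (List.zipWith (fun t c => c • sgn t.1 • monomial t.2) ws x).sum

theorem lt_of_mem_testForm {ws ρ : SignedSum n} {o : Bool × ℕ} (h : o ∈ testForm ws ρ) :
    o.2 < ws.length := by
  simp only [testForm, List.mem_flatMap, List.mem_range, List.mem_map] at h
  obtain ⟨i, hi, t, -, b, -, rfl⟩ := h
  exact hi

theorem linearForm_testForm (ws ρ : SignedSum n) (x : List ℂ) (h : x.length = ws.length) :
    linearForm (testForm ws ρ) x = ρ.act (combination ws x) := by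
  have hsum (l : List Bool) (i : ℕ) :
      linearForm (l.map fun b => (b, i)) x = total l * x.getD i 0 := by
    induction l with
    | nil => simp [linearForm, total]
    | cons b l ih =>
      simp only [linearForm, List.map_cons, List.sum_cons] at ih ⊢
      rw [ih, total_cons, add_mul]
  have hflat (l : List ℕ) : linearForm (l.flatMap fun i =>
      (ws[i]?).toList.flatMap fun t => (ρ.pair [t]).map fun b => (b, i)) x =
      (l.map fun i =>
        ((ws[i]?).map fun t => x.getD i 0 * ρ.act (SignedSum.eval [t])).getD 0).sum := by
    induction l with
    | nil => simp [linearForm]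
    | cons i l ih =>
      have happ (a b : List (Bool × ℕ)) :
          linearForm (a ++ b) x = linearForm a x + linearForm b x := by
        simp [linearForm]
      rw [List.flatMap_cons, happ, ih, List.map_cons, List.sum_cons]
      congr 1
      cases hi : ws[i]? with
      | none => simp [linearForm]
      | some t =>
        simp only [Option.toList_some, List.flatMap_cons, List.flatMap_nil, List.append_nil, hsum,
          SignedSum.total_pair, Option.map_some, Option.getD_some]
        ring
  rw [testForm, hflat]
  clear hflat hsum
  induction ws generalizing x with
  | nil => simp [combination]
  | cons t ws ih =>
    cases x with
    | nil => simp at h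
    | cons c x =>
      have := ih x (by simpa using h)
      rw [List.length_cons, List.range_succ_eq_map, List.map_cons, List.sum_cons, List.map_map]
      have hc : combination (t :: ws) (c :: x) = c • SignedSum.eval [t] + combination ws x := by
        simp [combination, SignedSum.eval]
      rw [hc, map_add, map_smul, ← this]
      simp [Function.comp_def]

theorem combination_mem_span (ws : SignedSum n) (x : List ℂ) :
    combination ws x ∈ Submodule.span ℂ (monomial '' {w | w ∈ ws.map Prod.snd}) := by
  suffices h : ∀ W : List (Word n), (∀ t ∈ ws, t.2 ∈ W) →
      combination ws x ∈ Submodule.span ℂ (monomial '' {w | w ∈ W}) from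
    h _ fun t ht => List.mem_map_of_mem ht
  intro W hW
  induction ws generalizing x with
  | nil => simp [combination]
  | cons t ws ih =>
    cases x with
    | nil => simp [combination]
    | cons c x =>
      have hc : combination (t :: ws) (c :: x) = c • sgn t.1 • monomial t.2 + combination ws x := by
        simp [combination]
      rw [hc]
      exact add_mem (Submodule.smul_mem _ _ (Submodule.smul_mem _ _ (Submodule.subset_span
        ⟨_, hW t List.mem_cons_self, rfl⟩))) (ih x fun s hs => hW s (List.mem_cons_of_mem _ hs))

/-- The program that decides, for coefficients `x`, whether the combination of the signed words `ws`
with coefficients `x` lies in the ideal. -/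
def membershipProgram (ws : SignedSum n) : List Instr :=
  compile ws.length ((membershipTests (ws.map Prod.snd)).map (testForm ws))

theorem accepts_membershipProgram_iff {ws : SignedSum n} {x : List ℂ} (h : x.length = ws.length) :
    Accepts (membershipProgram ws) x ↔ combination ws x ∈ idealQS n := by
  rw [mem_idealQS_iff_membershipTests (combination_mem_span ws x), membershipProgram, ← h,
    accepts_compile_iff, List.forall_mem_map]
  · simp only [linearForm_testForm _ _ _ h]
  · rw [List.forall_mem_map, h]
    exact fun ρ _ o ho => lt_of_mem_testForm ho

theorem accepts_iff_value_mem (p : Expr ℂ n) :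
    Accepts (membershipProgram ((words p).map fun w => (true, w))) (coeffs p) ↔
      value p ∈ idealQS n := by
  rw [accepts_membershipProgram_iff (by simp [words, coeffs])]
  have : combination ((words p).map fun w => (true, w)) (coeffs p) = value p := by
    induction p with
    | nil => simp [combination, value, words, coeffs]
    | cons t p ih => simp [combination, value, words, coeffs, sgn]
  rw [this]

theorem accepts_iff_proj_eq (x : Expr ℂ n × Expr ℂ n) :
    Accepts (membershipProgram (((words x.1).map fun w => (true, w)) ++
      (words x.2).map fun w => (false, w))) (coeffs x.1 ++ coeffs x.2) ↔
      proj n (value x.1) = proj n (value x.2) := by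
  obtain ⟨p, q⟩ := x
  rw [accepts_membershipProgram_iff (by simp [words, coeffs])]
  have hq : combination ((words q).map fun w => (false, w)) (coeffs q) = -value q := by
    induction q with
    | nil => simp [combination, value, words, coeffs]
    | cons t q ih =>
      simp only [combination, words, coeffs, value, List.map_cons, List.zipWith_cons_cons,
        List.sum_cons] at ih ⊢
      rw [ih]
      simp [sgn, add_comm]
  have : combination (((words p).map fun w => (true, w)) ++ (words q).map fun w => (false, w))
      (coeffs p ++ coeffs q) = value p - value q := by
    induction p with
    | nil => simpa [combination, value, words, coeffs] using hq
    | cons t p ih =>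
      simp only [combination, words, coeffs, value, List.map_cons, List.cons_append,
        List.zipWith_cons_cons, List.sum_cons] at ih ⊢
      rw [ih]
      simp [sgn, add_sub_assoc]
  rw [this, ← TwoSidedIdeal.rel_iff]
  exact (RingCon.eq _).symm

/-! ### Primitive recursiveness of the reduction -/

section

open Primrec

theorem primrec_beq : Primrec₂ fun b c : Bool => b == c := Primrec.dom_bool₂ _

theorem primrec_pair : Primrec₂ (SignedSum.pair (n := n)) := by
  have hinner : Primrec₂ fun (q : (SignedSum n × SignedSum n) × Bool × Word n)
      (t : Bool × Word n) =>
      if q.2.2 = t.2 then [q.2.1 == t.1] else [] :=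
    Primrec.ite
      (Primrec.eq.comp (snd.comp (snd.comp fst)) (snd.comp snd))
      (list_cons.comp (primrec_beq.comp (fst.comp (snd.comp fst)) (fst.comp snd)) (const []))
      (const [])
  exact list_flatMap (α := SignedSum n × SignedSum n) fst
    (g := fun p s => p.2.flatMap fun t => if s.2 = t.2 then [s.1 == t.1] else [])
    (list_flatMap (α := (SignedSum n × SignedSum n) × Bool × Word n) (snd.comp fst) hinner)

theorem primrec_scale : Primrec₂ (SignedSum.scale (n := n)) := by
  have hinner : Primrec₂ fun (q : (List Bool × SignedSum n) × Bool) (s : Bool × Word n) =>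
      (q.2 == s.1, s.2) :=
    Primrec.pair (primrec_beq.comp (snd.comp fst) (fst.comp snd)) (snd.comp snd)
  exact list_flatMap (α := List Bool × SignedSum n) fst
    (g := fun p b => p.2.map fun s => (b == s.1, s.2))
    (list_map (α := (List Bool × SignedSum n) × Bool) (snd.comp fst) hinner)

theorem primrec_balanced : Primrec balanced := by
  have h (b : Bool) : Primrec fun l : List Bool => (l.filter (· = b)).length :=
    list_length.comp (listFilter (PrimrecPred.comp (p := fun p : Bool × Bool => p.1 = p.2)
      Primrec.eq (Primrec.pair .id (const b))))
  exact (Primrec.eq.comp (h true) (h false)).decide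

theorem primrec_eliminateOne : Primrec₂ (eliminateOne (n := n)) := by
  let γ := (List (SignedSum n) × SignedSum n) × SignedSum n
  have hpair : Primrec fun q : γ => q.2.pair q.1.2 := primrec_pair.comp snd (snd.comp fst)
  have htest : Primrec fun q : γ => bif balanced (q.2.pair q.1.2) then [q.2] else [] :=
    Primrec.cond (primrec_balanced.comp hpair) (list_cons.comp snd (const [])) (const [])
  have hcomb : Primrec₂ fun (q : γ) (σ : SignedSum n) =>
      SignedSum.scale (σ.pair q.1.2) q.2 ++
        SignedSum.scale ((q.2.pair q.1.2).map fun b => !b) σ :=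
    list_append.comp
      (primrec_scale.comp (primrec_pair.comp snd (snd.comp (fst.comp fst))) (snd.comp fst))
      (primrec_scale.comp (list_map (hpair.comp fst) (Primrec.not.comp snd)) snd)
  exact list_flatMap (α := List (SignedSum n) × SignedSum n) fst
    (list_append.comp htest (list_map (fst.comp fst) hcomb))

theorem primrec_wordsUpTo : Primrec (wordsUpTo n) := by
  have hstep : Primrec₂ fun (_ : ℕ) (L : List (Word n)) => [] :: L.flatMap fun w =>
      (List.finRange n ×ˢ List.finRange n).map fun a => a :: w :=
    list_cons.comp (const []) (list_flatMap snd
      (list_map (const _) (list_cons.comp snd (snd.comp fst))))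
  refine (nat_rec₁ [[]] hstep).of_eq fun k => ?_
  induction k with
  | zero => rfl
  | succ k ih => rw [wordsUpTo, ← ih]

theorem primrec_pad : Primrec fun q : (Word n × Word n) × SignedSum n => q.2.pad q.1.1 q.1.2 :=
  list_map snd (Primrec.pair (fst.comp snd) (list_append.comp (fst.comp (fst.comp fst))
    (list_append.comp (snd.comp snd) (snd.comp (fst.comp fst)))))

theorem primrec_paddedList : Primrec (paddedList n) := by
  have hinner : Primrec₂ fun (q : (ℕ × Word n)) (w' : Word n) =>
      (relationList n).map fun f => f.pad q.2 w' :=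
    list_map (const _) (primrec_pad.comp
      (Primrec.pair (Primrec.pair (snd.comp (fst.comp fst)) (snd.comp fst)) snd))
  exact list_flatMap primrec_wordsUpTo (list_flatMap (primrec_wordsUpTo.comp fst) hinner)

theorem primrec_membershipTests : Primrec (membershipTests (n := n)) := by
  have hpad : Primrec fun ws : List (Word n) => paddedList n ws.flatten.length :=
    primrec_paddedList.comp (list_length.comp list_flatten)
  have hstart : Primrec fun ws : List (Word n) =>
      (ws ++ (paddedList n ws.flatten.length).flatten.map Prod.snd).map fun w => [(true, w)] :=
    list_map (list_append.comp .id (list_map (list_flatten.comp hpad) (snd.comp snd)))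
      (list_cons.comp (Primrec.pair (const true) snd) (const []))
  exact list_foldl hpad hstart (h := fun _ p => eliminateOne p.1 p.2)
    (primrec_eliminateOne.comp (fst.comp snd) (snd.comp snd))

theorem primrec_testForm : Primrec₂ (testForm (n := n)) := by
  let γ := (SignedSum n × SignedSum n) × ℕ
  have hinner : Primrec₂ fun (q : γ) (t : Bool × Word n) =>
      (q.1.2.pair [t]).map fun b => (b, q.2) :=
    list_map (primrec_pair.comp (snd.comp (fst.comp fst)) (list_cons.comp snd (const [])))
      (Primrec.pair snd (snd.comp (fst.comp fst)))
  exact list_flatMap (α := SignedSum n × SignedSum n) (list_range.comp (list_length.comp fst))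
    (list_flatMap (α := γ) (optionToList.comp (list_getElem?.comp (fst.comp fst) snd)) hinner)

theorem primrec_instr_mk {α : Type*} [Primcodable α]
    {f : α → Unit ⊕ (ℕ × ℕ) ⊕ (ℕ × ℕ) ⊕ (ℕ × ℕ) ⊕ ℕ}
    (hf : Primrec f) : Primrec fun a => Instr.equiv.symm (f a) :=
  Primrec.of_equiv_symm.comp hf

section Instructions

variable {α : Type*} [Primcodable α] {f g : α → ℕ}

theorem primrec_add (hf : Primrec f) (hg : Primrec g) : Primrec fun a => Instr.add (f a) (g a) :=
  primrec_instr_mk (sumInr.comp (sumInl.comp (hf.pair hg)))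

theorem primrec_sub (hf : Primrec f) (hg : Primrec g) : Primrec fun a => Instr.sub (f a) (g a) :=
  primrec_instr_mk (sumInr.comp (sumInr.comp (sumInl.comp (hf.pair hg))))

theorem primrec_mul (hf : Primrec f) (hg : Primrec g) : Primrec fun a => Instr.mul (f a) (g a) :=
  primrec_instr_mk (sumInr.comp (sumInr.comp (sumInr.comp (sumInl.comp (hf.pair hg)))))

theorem primrec_isZero (hf : Primrec f) : Primrec fun a => Instr.isZero (f a) :=
  primrec_instr_mk (sumInr.comp (sumInr.comp (sumInr.comp (sumInr.comp hf))))

end Instructions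

theorem primrec_addTerm : Primrec fun q : ℕ × List Instr × Bool × ℕ => addTerm q.1 q.2.1 q.2.2 := by
  have hlast : Primrec fun q : ℕ × List Instr × Bool × ℕ => q.1 + q.2.1.length - 1 :=
    nat_sub.comp (nat_add.comp fst (list_length.comp (fst.comp snd))) (const 1)
  have hi : Primrec fun q : ℕ × List Instr × Bool × ℕ => q.2.2.2 := snd.comp (snd.comp snd)
  exact list_concat.comp (fst.comp snd) (Primrec.cond (fst.comp (snd.comp snd))
    (primrec_add hlast hi) (primrec_sub hlast hi))

theorem primrec_addTest : Primrec fun q : ℕ × List Instr × List (Bool × ℕ) =>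
    addTest q.1 q.2.1 q.2.2 := by
  let γ := ℕ × List Instr × List (Bool × ℕ)
  have hQ : Primrec fun q : γ => q.2.2.foldl (addTerm q.1) (q.2.1 ++ [.sub 0 0]) :=
    list_foldl (snd.comp snd) (list_concat.comp (fst.comp snd) (const _))
      (h := fun (q : γ) p => addTerm q.1 p.1 p.2) (primrec_addTerm.comp
        (Primrec.pair (fst.comp fst) (Primrec.pair (fst.comp snd) (snd.comp snd))))
  have hlen : Primrec fun q : γ =>
      q.1 + (q.2.2.foldl (addTerm q.1) (q.2.1 ++ [.sub 0 0])).length :=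
    nat_add.comp fst (list_length.comp hQ)
  have hlast : Primrec fun q : γ => q.1 + q.2.1.length - 1 :=
    nat_sub.comp (nat_add.comp fst (list_length.comp (fst.comp snd))) (const 1)
  exact list_concat.comp (list_concat.comp hQ (primrec_isZero (nat_sub.comp hlen (const 1))))
    (primrec_mul hlen hlast)

theorem primrec_compile : Primrec₂ compile :=
  list_foldl (α := ℕ × List (List (Bool × ℕ))) snd (const [Instr.one])
    (h := fun q p => addTest q.1 p.1 p.2) (primrec_addTest.comp
    (Primrec.pair (fst.comp fst) (Primrec.pair (fst.comp snd) (snd.comp snd))))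

theorem primrec_membershipProgram : Primrec (membershipProgram (n := n)) :=
  primrec_compile.comp list_length (list_map (primrec_membershipTests.comp (list_map .id
    (snd.comp snd))) primrec_testForm)

/-! ### Running programs over a computable subring -/

section Interpreter

theorem computable_list_foldl {α β σ : Type*} [Primcodable α] [Primcodable β] [Primcodable σ]
    {f : α → List β} {g : α → σ} {h : α → σ × β → σ} (hf : Computable f) (hg : Computable g)
    (hh : Computable₂ h) : Computable fun a => (f a).foldl (fun s b => h a (s, b)) (g a) := by
  have hstep : Computable₂ fun (a : α) (p : ℕ × σ) =>
      Option.casesOn (motive := fun _ => σ) ((f a)[p.1]?) p.2 fun b => h a (p.2, b) :=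
    Computable.option_casesOn
      (Computable.list_getElem?.comp (hf.comp Computable.fst)
        (Computable.fst.comp Computable.snd))
      (Computable.snd.comp Computable.snd)
      (hh.comp (Computable.fst.comp Computable.fst)
        (Computable.pair (Computable.snd.comp (Computable.snd.comp Computable.fst)) Computable.snd))
  refine (Computable.nat_rec (Computable.list_length.comp hf) hg hstep).of_eq fun a => ?_
  have key (l : List β) (s : σ) : ∀ m ≤ l.length, Nat.rec (motive := fun _ => σ) s (fun k r =>
      Option.casesOn (motive := fun _ => σ) (l[k]?) r fun b => h a (r, b)) m =
      (l.take m).foldl (fun s b => h a (s, b)) s := by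
    intro m hm
    induction m with
    | zero => rfl
    | succ m ih =>
      rw [List.take_add_one, List.foldl_append, ← ih (by omega)]
      rw [List.getElem?_eq_getElem (by omega)]
      simp [List.getElem?_eq_getElem (show m < l.length by omega)]
  have := key (f a) (g a) _ le_rfl
  rwa [List.take_length] at this

variable {K : Subring ℂ}

open Classical in
/-- `Instr.exec` for registers in a subring. -/
noncomputable def execIn (K : Subring ℂ) (r : List K) : Instr → K
  | .one => 1
  | .add i j => r.getD i 0 + r.getD j 0
  | .sub i j => r.getD i 0 - r.getD j 0
  | .mul i j => r.getD i 0 * r.getD j 0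
  | .isZero i => if r.getD i 0 = 0 then 1 else 0

/-- `run` for registers in a subring. -/
noncomputable def runIn (K : Subring ℂ) (c : List Instr) (x : List K) : List K :=
  c.foldl (fun r s => r ++ [execIn K r s]) x

theorem coe_execIn (r : List K) (s : Instr) :
    (execIn K r s : ℂ) = s.exec (r.map fun a : K => (a : ℂ)) := by
  have h (i : ℕ) : ((r.getD i 0 : K) : ℂ) = (r.map fun a : K => (a : ℂ)).getD i 0 := by
    rw [List.getD_eq_getElem?_getD, List.getD_eq_getElem?_getD, List.getElem?_map]
    cases r[i]? <;> rfl
  cases s with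
  | one => rfl
  | add i j => simp only [execIn, Instr.exec, Subring.coe_add, h]
  | sub i j => simp only [execIn, Instr.exec, AddSubgroupClass.coe_sub, h]
  | mul i j => simp only [execIn, Instr.exec, Subring.coe_mul, h]
  | isZero i =>
    simp only [execIn, Instr.exec, ← h, ZeroMemClass.coe_eq_zero]
    split_ifs <;> rfl

theorem map_runIn (c : List Instr) (x : List K) :
    (runIn K c x).map (fun a : K => (a : ℂ)) = run c (x.map fun a : K => (a : ℂ)) := by
  induction c using List.reverseRecOn with
  | nil => rfl
  | append_singleton c s ih =>
    rw [run_concat, ← ih, ← coe_execIn, runIn, List.foldl_append]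
    simp [runIn]

theorem accepts_iff_runIn (c : List Instr) (x : List K) :
    Accepts c (x.map fun a : K => (a : ℂ)) ↔ (runIn K c x).reverse.headD 0 = 1 := by
  rw [Accepts, ← map_runIn]
  cases h : runIn K c x using List.reverseRecOn with
  | nil => simp
  | append_singleton r a => simp

variable [Primcodable K]

theorem computable_execIn (hadd : Computable₂ fun a b : K => a + b)
    (hmul : Computable₂ fun a b : K => a * b) :
    Computable₂ (execIn K) := by
  classical
  have hget {α : Type} [Primcodable α] {r : α → List K} {i : α → ℕ} (hr : Computable r)
      (hi : Computable i) : Computable fun a => (r a).getD (i a) 0 :=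
    (Primrec.list_getD (0 : K)).to_comp.comp hr hi
  -- Subtraction needs no assumption of its own, since `-1` is a constant.
  have hsub : Computable₂ fun a b : K => a - b :=
    (hadd.comp Computable.fst (hmul.comp (Computable.const (-1)) Computable.snd)).of_eq
      fun p => by ring
  have hzero : Computable fun a : K => if a = 0 then (1 : K) else 0 :=
    (Primrec.ite (Primrec.eq.comp .id (const 0)) (const 1) (const 0)).to_comp
  have hbin {α : Type} [Primcodable α] {op : K → K → K} (hop : Computable₂ op) {r : α → List K}
      {p : α → ℕ × ℕ} (hr : Computable r) (hp : Computable p) :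
      Computable fun a => op ((r a).getD (p a).1 0) ((r a).getD (p a).2 0) :=
    hop.comp (hget hr (Computable.fst.comp hp)) (hget hr (Computable.snd.comp hp))
  have hcode : Computable fun q : List K × Instr => Instr.equiv q.2 :=
    Primrec.of_equiv.to_comp.comp Computable.snd
  have h1 := Computable.fst (α := List K × Instr)
    (β := (ℕ × ℕ) ⊕ (ℕ × ℕ) ⊕ (ℕ × ℕ) ⊕ ℕ)
  have h2 := h1.comp (Computable.fst (β := (ℕ × ℕ) ⊕ (ℕ × ℕ) ⊕ ℕ))
  have h3 := h2.comp (Computable.fst (β := (ℕ × ℕ) ⊕ ℕ))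
  refine (Computable.sumCasesOn hcode (Computable.const (1 : K)).to₂
    (Computable.sumCasesOn Computable.snd
      (hbin hadd (Computable.fst.comp (h1.comp Computable.fst)) Computable.snd).to₂
      (Computable.sumCasesOn Computable.snd
        (hbin hsub (Computable.fst.comp (h2.comp Computable.fst)) Computable.snd).to₂
        (Computable.sumCasesOn Computable.snd
          (hbin hmul (Computable.fst.comp (h3.comp Computable.fst)) Computable.snd).to₂
          (hzero.comp (hget (Computable.fst.comp (h3.comp Computable.fst)) Computable.snd)).to₂
          ).to₂).to₂).to₂).of_eq fun q => ?_
  obtain ⟨r, s⟩ := q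
  cases s <;> rfl

/-- Acceptance by a computable family of programs is Turing decidable if the scalars lie in a
subring with computable addition and multiplication. -/
theorem computablePred_accepts (hadd : Computable₂ fun a b : K => a + b)
    (hmul : Computable₂ fun a b : K => a * b) {α : Type} [Primcodable α] {c : α → List Instr}
    {x : α → List K} (hc : Computable c) (hx : Computable x) :
    ComputablePred fun a => Accepts (c a) ((x a).map fun a : K => (a : ℂ)) := by
  classical
  have hrun : Computable fun a => runIn K (c a) (x a) :=
    computable_list_foldl hc hx (h := fun _ p => p.1 ++ [execIn K p.1 p.2])
      (Computable.list_concat.comp (Computable.fst.comp Computable.snd)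
        ((computable_execIn hadd hmul).comp (Computable.fst.comp Computable.snd)
          (Computable.snd.comp Computable.snd)))
  have hlast : Primrec fun l : List K => l.reverse.headD 0 :=
    (option_getD.comp (list_head?.comp list_reverse) (const 0)).of_eq fun l => by
      cases l.reverse <;> rfl
  have hone : PrimrecPred fun l : List K => l.reverse.headD 0 = 1 :=
    Primrec.eq.comp hlast (const 1)
  refine ComputablePred.of_eq (p := fun a => (runIn K (c a) (x a)).reverse.headD 0 = 1) ?_
    fun a => (accepts_iff_runIn _ _).symm
  exact Computable.computablePred (hone.decide.to_comp.comp hrun)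

end Interpreter

end

/-! ### The two reductions -/

theorem primrec_signed (b : Bool) :
    Primrec fun ws : List (Word n) => ws.map fun w => (b, w) :=
  Primrec.list_map .id (Primrec.pair (Primrec.const b) Primrec.snd)

theorem primrec_membership_reduction : Primrec fun ws : List (Word n) =>
    membershipProgram (ws.map fun w => (true, w)) :=
  primrec_membershipProgram.comp (primrec_signed true)

theorem primrec_equality_reduction : Primrec fun ws : List (Word n) × List (Word n) =>
    membershipProgram ((ws.1.map fun w => (true, w)) ++ ws.2.map fun w => (false, w)) :=
  primrec_membershipProgram.comp (Primrec.list_append.comp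
    ((primrec_signed true).comp Primrec.fst) ((primrec_signed false).comp Primrec.snd))

theorem primrec_words {K : Type} [Primcodable K] : Primrec (words (K := K) (n := n)) :=
  Primrec.list_map .id (Primrec.snd.comp Primrec.snd)

theorem primrec_coeffs {K : Type} [Primcodable K] : Primrec (coeffs (K := K) (n := n)) :=
  Primrec.list_map .id (Primrec.fst.comp Primrec.snd)

theorem words_toComplex {K : Subring ℂ} (p : Expr K n) : words (toComplex p) = words p := by
  simp [words, toComplex]

theorem coeffs_toComplex {K : Subring ℂ} (p : Expr K n) :
    coeffs (toComplex p) = (coeffs p).map fun a : K => (a : ℂ) := by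
  simp [coeffs, toComplex]

end QSym

theorem corollary1p3 (n : ℕ) :
    -- Turing decidability, for polynomials with coefficients in a computable subring of `ℂ`
    (∀ (K : Subring ℂ) [Primcodable K],
      Computable₂ (fun a b : K => a + b) → Computable₂ (fun a b : K => a * b) →
        ComputablePred (fun x : QSym.Expr K n × QSym.Expr K n =>
          QSym.proj n (QSym.value (QSym.toComplex x.1)) =
            QSym.proj n (QSym.value (QSym.toComplex x.2))) ∧
        ComputablePred (fun p : QSym.Expr K n =>
          QSym.value (QSym.toComplex p) ∈ QSym.idealQS n)) ∧
    -- decidability in exact arithmetic, for polynomials with arbitrary complex coefficients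
    QSym.ArithDecidable
      (fun x : QSym.Expr ℂ n × QSym.Expr ℂ n => (QSym.words x.1, QSym.words x.2))
      (fun x => QSym.coeffs x.1 ++ QSym.coeffs x.2)
      (fun x => QSym.proj n (QSym.value x.1) = QSym.proj n (QSym.value x.2)) ∧
    QSym.ArithDecidable
      (fun p : QSym.Expr ℂ n => QSym.words p)
      (fun p => QSym.coeffs p)
      (fun p => QSym.value p ∈ QSym.idealQS n) := by
  refine ⟨fun K _ hadd hmul => ⟨?_, ?_⟩,
    ⟨_, QSym.primrec_equality_reduction.to_comp, fun x => (QSym.accepts_iff_proj_eq x).symm⟩,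
    ⟨_, QSym.primrec_membership_reduction.to_comp, fun p => (QSym.accepts_iff_value_mem p).symm⟩⟩
  · refine (QSym.computablePred_accepts hadd hmul
      (QSym.primrec_equality_reduction.comp (Primrec.pair (QSym.primrec_words.comp Primrec.fst)
        (QSym.primrec_words.comp Primrec.snd))).to_comp
      (Primrec.list_append.comp (QSym.primrec_coeffs.comp Primrec.fst)
        (QSym.primrec_coeffs.comp Primrec.snd)).to_comp).of_eq fun x => ?_
    have h := QSym.accepts_iff_proj_eq (QSym.toComplex x.1, QSym.toComplex x.2)
    simp only [QSym.words_toComplex, QSym.coeffs_toComplex, ← List.map_append] at h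
    exact h
  · refine (QSym.computablePred_accepts hadd hmul
      (QSym.primrec_membership_reduction.comp QSym.primrec_words).to_comp
      QSym.primrec_coeffs.to_comp).of_eq fun p => ?_
    rw [← QSym.accepts_iff_value_mem, QSym.words_toComplex, QSym.coeffs_toComplex]
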